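/- Definitions. A symmetric association scheme with $n$ classes is a finite set $X$ with nonempty symmetric relations $R_0,\dots,R_n$ partitioning $X\times X$, where $R_0$ is the diagonal, such that for all $i,j,k$ and $(x,y)\in R_k$ the number $|\{z: (x,z)\in R_i,(z,y)\in R_j\}|$ depends only on $i,j,k$. Let $E_0=|X|^{-1}J,E_1,\dots,E_n$ be an ordering of the primitive idempotents of the span of the adjacency matrices, and define the Krein numbers by $E_i\circ E_j=|X|^{-1}\sum_k q_{ij}^kE_k$ ($\circ$ the entrywise product); put $a_j^*=q_{1,j}^j$, $b_j^*=q_{1,j+1}^j$, $c_j^*=q_{1,j-1}^j$, $b_n^*=c_0^*=0$. With respect to this ordering the scheme is $Q$-polynomial if $q_{1j}^k=0$ for $|j-k|>1$ and $q_{1j}^k\ne0$ for $|j-k|=1$; it is then $Q$-bipartite if $a_j^*=0$ for all $j$, and $Q$-antipodal if $b_j^*=c_{n-j}^*$ for all $j\neq\lfloor n/2\rfloor$. The $Q$-antipodal classes are the classes of the relation $(E_0+E_n)(x,y)\ne0$. The scheme is quadruply regular if for all $i_1,\dots,i_4$ and all $x_1,\dots,x_4\in X$ the number $|\{w\in X: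 (x_k,w)\in R_{i_k},\ k=1,\dots,4\}|$ depends only on $i_1,\dots,i_4$ and on the relations $R_{j_{kl}}\ni(x_k,x_l)$, $1\le k<l\le4$. Real mutually unbiased bases (MUB) in $\mathbb R^d$ are orthonormal bases $M_1,\dots,M_f$ of $\mathbb R^d$ such that $\langle x,y\rangle=\pm1/\sqrt d$ for $x,y$ from different bases; write $M=\bigcup_i M_i$. The MUB is called maximal if $f=d/2+1$ (the general upper bound for $f$). Theorem. (1) Let $(X,\{R_i\}_{i=0}^4)$ be a $4$-class symmetric association scheme that is $Q$-polynomial, $Q$-antipodal and $Q$-bipartite with respect to an ordering $E_0,\dots,E_4$, let $d=\operatorname{rank}E_1$, and let $f$ be the number of $Q$-antipodal classes. Then the scheme is quadruply regular if and only if $f=\frac d2+1$. Moreover every $Q$-antipodal class has size $2d$, and there are real MUB $M_1,\dots,M_f$ in $\mathbb R^d$ and a bijection $\varphi:X\to M\cup(-M)$ with $\langle\varphi(x),\varphi(y)\rangle=\frac{|X|}{d}E_1(x,y)$ for all $x,y\in X$ which, up to a permutation of the relations, carries $R_0,\dots,R_4$ to the relations $\langle x,y\rangle=1,\frac1{\sqrt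 d},0,-\frac1{\sqrt d},-1$. (2) Conversely, let $M_1,\dots,M_f$ be real MUB in $\mathbb R^d$ with $d,f\ge2$. Then $M\cup(-M)$ with the relations $\langle x,y\rangle=1,\frac1{\sqrt d},0,-\frac1{\sqrt d},-1$ is a $4$-class symmetric association scheme that is $Q$-polynomial, $Q$-antipodal and $Q$-bipartite with respect to some ordering of its primitive idempotents with $\operatorname{rank}E_1=d$ and with $f$ $Q$-antipodal classes, and it is quadruply regular if and only if $f=\frac d2+1$, that is, if and only if the MUB is maximal. -/

import Mathlib

open scoped Matrix

noncomputable section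

/-- The relations `R 0, …, R n` on the finite set `X` form a symmetric association scheme
with `n` classes. -/
structure IsSymmetricAssociationScheme {X : Type*} [Fintype X] {n : ℕ}
    (R : Fin (n + 1) → X → X → Prop) : Prop where
  rel_nonempty : ∀ i, ∃ x y, R i x y
  rel_partition : ∀ x y, ∃! i, R i x y
  rel_zero_iff : ∀ x y, R 0 x y ↔ x = y
  rel_symm : ∀ i x y, R i x y → R i y x
  intersection_number : ∀ i j k, ∃ p : ℕ, ∀ x y, R k x y →
    {z | R i x z ∧ R j z y}.ncard = p

open Classical in
/-- The adjacency matrix of the `i`-th relation. -/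
def adjacency {X : Type*} {n : ℕ} (R : Fin (n + 1) → X → X → Prop) (i : Fin (n + 1)) :
    Matrix X X ℝ :=
  Matrix.of fun x y => if R i x y then 1 else 0

/-- The Bose-Mesner algebra (as a space of matrices): the span of the adjacency matrices. -/
def boseMesner {X : Type*} {n : ℕ} (R : Fin (n + 1) → X → X → Prop) :
    Submodule ℝ (Matrix X X ℝ) :=
  Submodule.span ℝ (Set.range (adjacency R))

/-- `E 0, …, E n` is an ordering of the primitive idempotents of the Bose-Mesner algebra, with
`E 0 = |X|⁻¹ J`.  The algebra of an `n`-class scheme is commutative of dimension `n + 1`, so a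
decomposition of `1` into `n + 1` nonzero mutually orthogonal idempotents of the algebra
consists exactly of its primitive idempotents. -/
structure IsPrimitiveIdempotentOrdering {X : Type*} [Fintype X] [DecidableEq X] {n : ℕ}
    (R : Fin (n + 1) → X → X → Prop) (E : Fin (n + 1) → Matrix X X ℝ) : Prop where
  mem_boseMesner : ∀ i, E i ∈ boseMesner R
  zero_eq : E 0 = Matrix.of fun _ _ => (Fintype.card X : ℝ)⁻¹
  idem : ∀ i, E i * E i = E i
  orth : ∀ i j, i ≠ j → E i * E j = 0
  sum_eq_one : ∑ i, E i = 1
  ne_zero : ∀ i, E i ≠ 0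

/-- The Krein number `q_{ij}^k`, that is, the coefficient in
`E i ∘ E j = |X|⁻¹ ∑ k, q_{ij}^k E k` (entrywise product), extracted by
multiplying with `E k` and taking the trace; see `hadamard_eq_sum_kreinNumber`. -/
def kreinNumber {X : Type*} [Fintype X] {n : ℕ} (E : Fin (n + 1) → Matrix X X ℝ)
    (i j k : Fin (n + 1)) : ℝ :=
  Fintype.card X * ((E i ⊙ E j) * E k).trace / (E k).trace

/-- The scheme is `Q`-polynomial with respect to the ordering `E`: the matrix of Krein numbers
`q_{1j}^k` is irreducible tridiagonal. -/
def IsQPolynomial {X : Type*} [Fintype X] {n : ℕ} (E : Fin (n + 1) → Matrix X X ℝ) : Prop :=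
  ∀ j k : Fin (n + 1),
    ((j : ℕ) + 1 < k ∨ (k : ℕ) + 1 < j → kreinNumber E 1 j k = 0) ∧
    ((j : ℕ) + 1 = k ∨ (k : ℕ) + 1 = j → kreinNumber E 1 j k ≠ 0)

/-- `a_j^* = q_{1,j}^j`. -/
def kreinA {X : Type*} [Fintype X] {n : ℕ} (E : Fin (n + 1) → Matrix X X ℝ)
    (j : Fin (n + 1)) : ℝ :=
  kreinNumber E 1 j j

/-- `b_j^* = q_{1,j+1}^j` for `j < n`, and `b_n^* = 0`. -/
def kreinB {X : Type*} [Fintype X] {n : ℕ} (E : Fin (n + 1) → Matrix X X ℝ)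
    (j : Fin (n + 1)) : ℝ :=
  if h : (j : ℕ) < n then kreinNumber E 1 ⟨j + 1, by omega⟩ j else 0

/-- `c_j^* = q_{1,j-1}^j` for `j > 0`, and `c_0^* = 0`. -/
def kreinC {X : Type*} [Fintype X] {n : ℕ} (E : Fin (n + 1) → Matrix X X ℝ)
    (j : Fin (n + 1)) : ℝ :=
  if 0 < (j : ℕ) then kreinNumber E 1 ⟨j - 1, by omega⟩ j else 0

/-- `Q`-bipartite: `a_j^* = 0` for all `j`. -/
def IsQBipartite {X : Type*} [Fintype X] {n : ℕ} (E : Fin (n + 1) → Matrix X X ℝ) : Prop :=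
  ∀ j, kreinA E j = 0

/-- `Q`-antipodal: `b_j^* = c_{n-j}^*` for all `j`, except possibly `j = ⌊n/2⌋`. -/
def IsQAntipodal {X : Type*} [Fintype X] {n : ℕ} (E : Fin (n + 1) → Matrix X X ℝ) : Prop :=
  ∀ j : Fin (n + 1), (j : ℕ) ≠ n / 2 → kreinB E j = kreinC E j.rev

/-- The `Q`-antipodal class of `x`: the class of `x` under the equivalence relation whose
adjacency matrix is a multiple of `E 0 + E n`. -/
def qAntipodalClass {X : Type*} {n : ℕ} (E : Fin (n + 1) → Matrix X X ℝ) (x : X) : Set X :=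
  {y | (E 0 + E (Fin.last n)) x y ≠ 0}

/-- The number of `Q`-antipodal classes. -/
def numQAntipodalClasses {X : Type*} {n : ℕ} (E : Fin (n + 1) → Matrix X X ℝ) : ℕ :=
  (Set.range (qAntipodalClass E)).ncard

/-- Quadruple regularity. -/
def IsQuadruplyRegular {X : Type*} {n : ℕ} (R : Fin (n + 1) → X → X → Prop) : Prop :=
  ∀ (i : Fin 4 → Fin (n + 1)) (j : Fin 4 → Fin 4 → Fin (n + 1)), ∃ c : ℕ,
    ∀ x : Fin 4 → X, (∀ k l, k < l → R (j k l) (x k) (x l)) →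
      {w | ∀ k, R (i k) (x k) w}.ncard = c

/-- A family of `f` orthonormal bases of `ℝ^d` is mutually unbiased. -/
def IsMUB {d f : ℕ}
    (M : Fin f → OrthonormalBasis (Fin d) ℝ (EuclideanSpace ℝ (Fin d))) : Prop :=
  ∀ a b, a ≠ b → ∀ i j, inner ℝ (M a i) (M b j) = 1 / √(d : ℝ) ∨
    inner ℝ (M a i) (M b j) = -(1 / √(d : ℝ))

/-- The set `M ∪ (-M)`. -/
def mubPoints {d f : ℕ}
    (M : Fin f → OrthonormalBasis (Fin d) ℝ (EuclideanSpace ℝ (Fin d))) :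
    Set (EuclideanSpace ℝ (Fin d)) :=
  {v | ∃ a i, v = M a i ∨ v = -M a i}

theorem mubPoints_finite {d f : ℕ}
    (M : Fin f → OrthonormalBasis (Fin d) ℝ (EuclideanSpace ℝ (Fin d))) :
    (mubPoints M).Finite := by
  refine ((Set.finite_range fun p : Fin f × Fin d => M p.1 p.2).union
    (Set.finite_range fun p : Fin f × Fin d => -M p.1 p.2)).subset ?_
  rintro v ⟨a, i, h | h⟩
  · exact Or.inl ⟨(a, i), h.symm⟩
  · exact Or.inr ⟨(a, i), h.symm⟩

instance mubPointsFintype {d f : ℕ}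
    (M : Fin f → OrthonormalBasis (Fin d) ℝ (EuclideanSpace ℝ (Fin d))) :
    Fintype (mubPoints M) :=
  (mubPoints_finite M).fintype

instance mubPointsDecidableEq {d f : ℕ}
    (M : Fin f → OrthonormalBasis (Fin d) ℝ (EuclideanSpace ℝ (Fin d))) :
    DecidableEq (mubPoints M) :=
  Classical.decEq _

/-- The angles `1, 1/√d, 0, -1/√d, -1`. -/
def mubAngle (d : ℕ) : Fin 5 → ℝ :=
  ![1, 1 / √(d : ℝ), 0, -(1 / √(d : ℝ)), -1]

/-- The relations on `M ∪ (-M)` given by the angles. -/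
def mubRel {d f : ℕ}
    (M : Fin f → OrthonormalBasis (Fin d) ℝ (EuclideanSpace ℝ (Fin d)))
    (k : Fin 5) (x y : mubPoints M) : Prop :=
  inner ℝ (x : EuclideanSpace ℝ (Fin d)) (y : EuclideanSpace ℝ (Fin d)) = mubAngle d k

/-- The adjacency matrices of a scheme are closed under the entrywise product. -/
theorem boseMesner_hadamard {X : Type*} [Fintype X] {n : ℕ} {R : Fin (n + 1) → X → X → Prop}
    (hR : IsSymmetricAssociationScheme R) {A B : Matrix X X ℝ} (hA : A ∈ boseMesner R)
    (hB : B ∈ boseMesner R) : A ⊙ B ∈ boseMesner R := by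
  unfold boseMesner at *
  induction hA using Submodule.span_induction with
  | mem A hA =>
    induction hB using Submodule.span_induction with
    | mem B hB =>
      obtain ⟨i, rfl⟩ := hA
      obtain ⟨j, rfl⟩ := hB
      by_cases hij : i = j
      · subst hij
        have : adjacency R i ⊙ adjacency R i = adjacency R i := by
          ext x y; simp [adjacency]
        rw [this]; exact Submodule.subset_span ⟨i, rfl⟩
      · have : adjacency R i ⊙ adjacency R j = 0 := by
          ext x y
          simp only [adjacency, Matrix.hadamard_apply, Matrix.of_apply, Matrix.zero_apply]
          split_ifs with h1 h2 <;> simp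
          exact hij ((hR.rel_partition x y).unique h1 h2)
        rw [this]; exact Submodule.zero_mem _
    | zero => simp
    | add x y _ _ hx hy => rw [Matrix.hadamard_add]; exact Submodule.add_mem _ hx hy
    | smul a x _ hx => rw [Matrix.hadamard_smul]; exact Submodule.smul_mem _ _ hx
  | zero => simp
  | add x y _ _ hx hy => rw [Matrix.add_hadamard]; exact Submodule.add_mem _ hx hy
  | smul a x _ hx => rw [Matrix.smul_hadamard]; exact Submodule.smul_mem _ _ hx

/-- The defining expansion of the Krein numbers. -/
theorem hadamard_eq_sum_kreinNumber {X : Type*} [Fintype X] [DecidableEq X] {n : ℕ}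
    {R : Fin (n + 1) → X → X → Prop} {E : Fin (n + 1) → Matrix X X ℝ}
    (hR : IsSymmetricAssociationScheme R) (hE : IsPrimitiveIdempotentOrdering R E)
    (i j : Fin (n + 1)) :
    E i ⊙ E j = (Fintype.card X : ℝ)⁻¹ • ∑ k, kreinNumber E i j k • E k := by
  have hmul : ∀ (c : Fin (n + 1) → ℝ) k, (∑ l, c l • E l) * E k = c k • E k := by
    intro c k
    rw [Finset.sum_mul, Finset.sum_eq_single k]
    · rw [Matrix.smul_mul, hE.idem]
    · intro l _ hl; rw [Matrix.smul_mul, hE.orth l k hl, smul_zero]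
    · simp
  have hli : LinearIndependent ℝ E := by
    rw [Fintype.linearIndependent_iff]
    intro c hc k
    have h := hmul c k
    rw [hc, zero_mul] at h
    exact (smul_eq_zero.mp h.symm).resolve_right (hE.ne_zero k)
  have hle : Submodule.span ℝ (Set.range E) ≤ boseMesner R :=
    Submodule.span_le.mpr (by rintro _ ⟨k, rfl⟩; exact hE.mem_boseMesner k)
  have heq : Submodule.span ℝ (Set.range E) = boseMesner R := by
    apply Submodule.eq_of_le_of_finrank_le hle
    rw [finrank_span_eq_card hli]
    exact finrank_range_le_card (R := ℝ) (adjacency R)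
  have hmem : E i ⊙ E j ∈ Submodule.span ℝ (Set.range E) := by
    rw [heq]; exact boseMesner_hadamard hR (hE.mem_boseMesner i) (hE.mem_boseMesner j)
  obtain ⟨c, hc⟩ := (Submodule.mem_span_range_iff_exists_fun ℝ).mp hmem
  have hsymm' : ∀ A ∈ boseMesner R, Aᵀ = A := by
    intro A h
    unfold boseMesner at h
    induction h using Submodule.span_induction with
    | mem A hA =>
      obtain ⟨l, rfl⟩ := hA
      ext x y
      have : R l y x ↔ R l x y := ⟨hR.rel_symm l y x, hR.rel_symm l x y⟩
      by_cases h : R l x y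
      · simp [adjacency, h, this.mpr h]
      · simp [adjacency, h, mt this.mp h]
    | zero => simp
    | add x y _ _ hx hy => rw [Matrix.transpose_add, hx, hy]
    | smul a x _ hx => rw [Matrix.transpose_smul, hx]
  have hsymm : ∀ k, (E k)ᵀ = E k := fun k => hsymm' _ (hE.mem_boseMesner k)
  have htr : ∀ k, (E k).trace ≠ 0 := by
    intro k h
    apply hE.ne_zero k
    rw [← Matrix.trace_conjTranspose_mul_self_eq_zero_iff (A := E k),
      Matrix.conjTranspose_eq_transpose_of_trivial, hsymm, hE.idem, h]
  have hX : (Fintype.card X : ℝ) ≠ 0 := by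
    obtain ⟨x, _⟩ := hR.rel_nonempty 0
    exact_mod_cast (Fintype.card_pos_iff.mpr ⟨x⟩).ne'
  have hk : ∀ k, kreinNumber E i j k = Fintype.card X * c k := by
    intro k
    unfold kreinNumber
    rw [← hc, hmul, Matrix.trace_smul, smul_eq_mul, div_eq_iff (htr k), mul_assoc]
  rw [Finset.smul_sum, ← hc]
  refine Finset.sum_congr rfl fun k _ => ?_
  rw [hk, smul_smul, inv_mul_cancel_left₀ hX]

end

/-!
For a `Q`-antipodal and `Q`-bipartite 4-class scheme, all Krein numbers `q_{1j}^k` are determined by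
`d` and a second parameter `r`.  They are the coefficients of three-term recurrences for the entries
of `|X| E_j`, which force the entries of `|X| E_1` to be `0`, `±√d` or `±d`.  Hence `(|X| / d) E_1`
is the Gram matrix of unit vectors in `ℝ^d` with the angles of `M ∪ (-M)`, and `E_0 + E_4` tells
which of them lie, up to sign, in a common basis.  Counting gives `2d` points in each class, and
`r = f`.

Quadruple regularity of `M ∪ (-M)` is governed by the fourth moment
`∑_w ⟪u, w⟫ ⟪v, w⟫ ⟪y, w⟫ ⟪z, w⟫`, since the lower moments are those of a tight frame.  If the
fourth moment of points depends only on their Gram matrix, it vanishes on orthogonal quadruples,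
and a comparison of two of its values yields `f = d / 2 + 1`.  Conversely, for `f = d / 2 + 1` the
fourth moment is the isotropic 4-linear form.
-/

open scoped InnerProductSpace

/-! ### Orthogonal idempotents and Krein numbers -/

theorem sum_smul_mul_of_orthogonalIdempotents {𝕜 A ι : Type*} [CommSemiring 𝕜] [Semiring A]
    [Algebra 𝕜 A] [Fintype ι] {e : ι → A} (he : OrthogonalIdempotents e) (c : ι → 𝕜) (k : ι) :
    (∑ l, c l • e l) * e k = c k • e k := by
  classical
  simp [Finset.sum_mul, he.mul_eq]

theorem linearIndependent_of_orthogonalIdempotents {𝕜 A ι : Type*} [Field 𝕜] [Ring A]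
    [Algebra 𝕜 A] {e : ι → A} (he : OrthogonalIdempotents e) (ne_zero : ∀ i, e i ≠ 0) :
    LinearIndependent 𝕜 e := by
  classical
  rw [linearIndependent_iff']
  intro s c hc k hk
  have h : (∑ l ∈ s, c l • e l) * e k = c k • e k := by
    simp [Finset.sum_mul, he.mul_eq, hk]
  rw [hc, zero_mul] at h
  exact (smul_eq_zero.mp h.symm).resolve_right (ne_zero k)

theorem rank_eq_trace_of_isIdempotentElem {𝕜 X : Type*} [Field 𝕜] [Fintype X]
    {A : Matrix X X 𝕜} (hA : IsIdempotentElem A) : (A.rank : 𝕜) = A.trace := by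
  classical
  have hidem : IsIdempotentElem (Matrix.toLin' A) := hA.map Matrix.toLinAlgEquiv'
  rw [← Matrix.trace_toLin'_eq, (LinearMap.IsIdempotentElem.isProj_range _ hidem).trace]
  rfl

theorem isQuadruplyRegular_of_equiv {X Y : Type*} {n : ℕ} {R : Fin (n + 1) → X → X → Prop}
    {S : Fin (n + 1) → Y → Y → Prop} (φ : X ≃ Y) (σ : Equiv.Perm (Fin (n + 1)))
    (h : ∀ k x y, R k x y ↔ S (σ k) (φ x) (φ y)) (hS : IsQuadruplyRegular S) :
    IsQuadruplyRegular R := by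
  intro i j
  obtain ⟨c, hc⟩ := hS (fun k => σ (i k)) (fun k l => σ (j k l))
  refine ⟨c, fun x hx => ?_⟩
  rw [← hc (fun k => φ (x k)) fun k l hkl => (h _ _ _).mp (hx k l hkl),
    ← Set.ncard_preimage_of_injective_subset_range φ.injective (by simp)]
  simp only [h, Set.preimage_ofPred_eq]

theorem isQuadruplyRegular_iff_of_equiv {X Y : Type*} {n : ℕ} {R : Fin (n + 1) → X → X → Prop}
    {S : Fin (n + 1) → Y → Y → Prop} (φ : X ≃ Y) (σ : Equiv.Perm (Fin (n + 1)))
    (h : ∀ k x y, R k x y ↔ S (σ k) (φ x) (φ y)) :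
    IsQuadruplyRegular R ↔ IsQuadruplyRegular S :=
  ⟨isQuadruplyRegular_of_equiv φ.symm σ.symm fun k x y => by simp [h],
    isQuadruplyRegular_of_equiv φ σ h⟩

section BoseMesner

variable {X : Type*} {n : ℕ} {R : Fin (n + 1) → X → X → Prop}

theorem adjacency_mem_boseMesner (k : Fin (n + 1)) : adjacency R k ∈ boseMesner R :=
  Submodule.subset_span ⟨k, rfl⟩

theorem apply_eq_of_mem_boseMesner (hR : ∀ x y, ∃! i, R i x y) {A : Matrix X X ℝ}
    (hA : A ∈ boseMesner R) {k : Fin (n + 1)} {x y x' y' : X} (h : R k x y) (h' : R k x' y') :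
    A x y = A x' y' := by
  unfold boseMesner at hA
  induction hA using Submodule.span_induction with
  | mem A hA =>
    obtain ⟨i, rfl⟩ := hA
    have hi {x y} (hk : R k x y) : R i x y ↔ i = k :=
      ⟨fun hi => (hR x y).unique hi hk, fun e => e ▸ hk⟩
    simp [adjacency, hi h, hi h']
  | zero => rfl
  | add A B _ _ hA hB => simp [hA, hB]
  | smul a A _ hA => simp [hA]

theorem mem_boseMesner_of_apply_eq (hR : ∀ x y, ∃! i, R i x y) {A : Matrix X X ℝ}
    (c : Fin (n + 1) → ℝ) (h : ∀ k x y, R k x y → A x y = c k) : A ∈ boseMesner R := by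
  have hA : A = ∑ k, c k • adjacency R k := by
    ext x y
    obtain ⟨k, hk, huniq⟩ := hR x y
    have hl (l) : R l x y ↔ l = k := ⟨huniq l, fun e => e ▸ hk⟩
    simp [h k x y hk, Matrix.sum_apply, adjacency, hl]
  rw [hA]
  exact Submodule.sum_mem _ fun k _ => Submodule.smul_mem _ _ (adjacency_mem_boseMesner k)

theorem adjacency_mul_apply [Fintype X] (i j : Fin (n + 1)) (x y : X) :
    (adjacency R i * adjacency R j) x y = ({z | R i x z ∧ R j z y}.ncard : ℝ) := by
  classical
  rw [Matrix.mul_apply, Set.ncard_eq_toFinset_card']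
  simp [adjacency, ← ite_and, and_comm]

variable [Fintype X] [DecidableEq X] {E : Fin (n + 1) → Matrix X X ℝ}

theorem span_eq_boseMesner (he : OrthogonalIdempotents E) (mem : ∀ i, E i ∈ boseMesner R)
    (ne_zero : ∀ i, E i ≠ 0) : Submodule.span ℝ (Set.range E) = boseMesner R := by
  apply Submodule.eq_of_le_of_finrank_le
    (Submodule.span_le.mpr (by rintro _ ⟨k, rfl⟩; exact mem k))
  rw [finrank_span_eq_card (linearIndependent_of_orthogonalIdempotents he ne_zero)]
  exact finrank_range_le_card (R := ℝ) (adjacency R)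

theorem mul_mem_boseMesner (he : OrthogonalIdempotents E) (mem : ∀ i, E i ∈ boseMesner R)
    (ne_zero : ∀ i, E i ≠ 0) {A B : Matrix X X ℝ} (hA : A ∈ boseMesner R)
    (hB : B ∈ boseMesner R) : A * B ∈ boseMesner R := by
  rw [← span_eq_boseMesner he mem ne_zero, Submodule.mem_span_range_iff_exists_fun] at hA hB
  obtain ⟨a, rfl⟩ := hA
  obtain ⟨b, rfl⟩ := hB
  simp only [Finset.mul_sum, Matrix.mul_smul, sum_smul_mul_of_orthogonalIdempotents he]
  exact Submodule.sum_mem _ fun m _ => Submodule.smul_mem _ _ (Submodule.smul_mem _ _ (mem m))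

theorem isSymmetricAssociationScheme_of_orthogonalIdempotents (he : OrthogonalIdempotents E)
    (mem : ∀ i, E i ∈ boseMesner R) (ne_zero : ∀ i, E i ≠ 0)
    (rel_nonempty : ∀ i, ∃ x y, R i x y) (rel_partition : ∀ x y, ∃! i, R i x y)
    (rel_zero_iff : ∀ x y, R 0 x y ↔ x = y) (rel_symm : ∀ i x y, R i x y → R i y x) :
    IsSymmetricAssociationScheme R where
  rel_nonempty := rel_nonempty
  rel_partition := rel_partition
  rel_zero_iff := rel_zero_iff
  rel_symm := rel_symm
  intersection_number i j k := by
    obtain ⟨x, y, hxy⟩ := rel_nonempty k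
    refine ⟨{z | R i x z ∧ R j z y}.ncard, fun x' y' h' => ?_⟩
    have hmul := mul_mem_boseMesner he mem ne_zero (adjacency_mem_boseMesner i)
      (adjacency_mem_boseMesner j)
    have hcount := apply_eq_of_mem_boseMesner rel_partition hmul h' hxy
    rw [adjacency_mul_apply, adjacency_mul_apply] at hcount
    exact_mod_cast hcount

theorem kreinNumber_eq_of_hadamard_eq (he : OrthogonalIdempotents E) {i j : Fin (n + 1)}
    {c : Fin (n + 1) → ℝ} (h : E i ⊙ E j = ∑ l, c l • E l) {k : Fin (n + 1)}
    (hk : (E k).trace ≠ 0) : kreinNumber E i j k = Fintype.card X * c k := by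
  rw [kreinNumber, h, sum_smul_mul_of_orthogonalIdempotents he, Matrix.trace_smul, smul_eq_mul,
    div_eq_iff hk, mul_assoc]

end BoseMesner

section Scheme

variable {X : Type*} [Fintype X] {n : ℕ}
  {R : Fin (n + 1) → X → X → Prop} {E : Fin (n + 1) → Matrix X X ℝ}

theorem IsSymmetricAssociationScheme.card_ne_zero (hR : IsSymmetricAssociationScheme R) :
    (Fintype.card X : ℝ) ≠ 0 := by
  obtain ⟨x, _⟩ := hR.rel_nonempty 0
  exact_mod_cast (Fintype.card_pos_iff.mpr ⟨x⟩).ne'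

theorem IsSymmetricAssociationScheme.isSymm_of_mem_boseMesner
    (hR : IsSymmetricAssociationScheme R) {A : Matrix X X ℝ} (hA : A ∈ boseMesner R) :
    A.IsSymm := by
  ext x y
  obtain ⟨k, hk, _⟩ := hR.rel_partition x y
  exact apply_eq_of_mem_boseMesner hR.rel_partition hA (hR.rel_symm k x y hk) hk

variable [DecidableEq X]

namespace IsPrimitiveIdempotentOrdering

theorem orthogonalIdempotents (hE : IsPrimitiveIdempotentOrdering R E) :
    OrthogonalIdempotents E :=
  ⟨hE.idem, hE.orth⟩

theorem trace_ne_zero (hE : IsPrimitiveIdempotentOrdering R E) (i : Fin (n + 1)) :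
    (E i).trace ≠ 0 := by
  have hidem : IsIdempotentElem (Matrix.toLin' (E i)) :=
    IsIdempotentElem.map (hE.idem i) Matrix.toLinAlgEquiv'
  rw [← Matrix.trace_toLin'_eq, Ne, LinearMap.IsIdempotentElem.trace_eq_zero_iff hidem,
    LinearEquiv.map_eq_zero_iff]
  exact hE.ne_zero i

theorem card_mul_diag (hR : IsSymmetricAssociationScheme R)
    (hE : IsPrimitiveIdempotentOrdering R E) (i : Fin (n + 1)) (x : X) :
    Fintype.card X * E i x x = (E i).trace := by
  have h (y) : E i y y = E i x x :=
    apply_eq_of_mem_boseMesner hR.rel_partition (hE.mem_boseMesner i)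
      ((hR.rel_zero_iff y y).mpr rfl) ((hR.rel_zero_iff x x).mpr rfl)
  simp [Matrix.trace, h]

theorem rel_of_apply_eq (hE : IsPrimitiveIdempotentOrdering R E) {x y x' y' : X}
    (h : ∀ i, E i x y = E i x' y') {k : Fin (n + 1)} (hk : R k x y) : R k x' y' := by
  have hmem : adjacency R k ∈ Submodule.span ℝ (Set.range E) := by
    rw [span_eq_boseMesner hE.orthogonalIdempotents hE.mem_boseMesner hE.ne_zero]
    exact adjacency_mem_boseMesner k
  obtain ⟨c, hc⟩ := (Submodule.mem_span_range_iff_exists_fun ℝ).mp hmem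
  have heq : adjacency R k x y = adjacency R k x' y' := by
    simp [← hc, Matrix.sum_apply, h]
  by_contra hk'
  simp [adjacency, hk, hk'] at heq

theorem kreinNumber_zero_right (hR : IsSymmetricAssociationScheme R)
    (hE : IsPrimitiveIdempotentOrdering R E) (i k : Fin (n + 1)) :
    kreinNumber E i 0 k = if k = i then 1 else 0 := by
  have h : E i ⊙ E 0 =
      ∑ l, (if l = i then (Fintype.card X : ℝ)⁻¹ else 0) • E l := by
    ext x y
    simp [hE.zero_eq, mul_comm]
  rw [kreinNumber_eq_of_hadamard_eq hE.orthogonalIdempotents h (hE.trace_ne_zero k)]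
  split_ifs
  · rw [mul_inv_cancel₀ hR.card_ne_zero]
  · rw [mul_zero]

theorem sum_kreinNumber (hR : IsSymmetricAssociationScheme R)
    (hE : IsPrimitiveIdempotentOrdering R E) (i k : Fin (n + 1)) :
    ∑ j, kreinNumber E i j k = (E i).trace := by
  have hN := hR.card_ne_zero
  have hhadamard : ∑ j, E i ⊙ E j =
      ((Fintype.card X : ℝ)⁻¹ * (E i).trace) • (1 : Matrix X X ℝ) := by
    ext x y
    rw [Matrix.sum_apply]
    simp only [Matrix.hadamard_apply, ← Finset.mul_sum, Matrix.smul_apply]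
    rw [← Matrix.sum_apply, hE.sum_eq_one, Matrix.one_apply]
    split_ifs with hxy
    · subst hxy
      simp [← hE.card_mul_diag hR i x, hN]
    · simp
  have htrace : ∑ j, ((E i ⊙ E j) * E k).trace =
      (Fintype.card X : ℝ)⁻¹ * (E i).trace * (E k).trace := by
    rw [← Matrix.trace_sum, ← Finset.sum_mul, hhadamard, Matrix.smul_mul, one_mul,
      Matrix.trace_smul, smul_eq_mul]
  have hk := hE.trace_ne_zero k
  simp only [kreinNumber, mul_div_assoc]
  rw [← Finset.mul_sum, ← Finset.sum_div, htrace]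
  field_simp

end IsPrimitiveIdempotentOrdering

end Scheme

/-! ### Points of `M ∪ (-M)` -/

section MUBPoints

variable {d f : ℕ} {M : Fin f → OrthonormalBasis (Fin d) ℝ (EuclideanSpace ℝ (Fin d))}

theorem inv_sqrt_pos (hd : 2 ≤ d) : 0 < 1 / √(d : ℝ) := by
  have : (0 : ℝ) < d := by exact_mod_cast (by lia : 0 < d)
  positivity

theorem inv_sqrt_sq : (1 / √(d : ℝ)) ^ 2 = 1 / d := by
  rw [div_pow, Real.sq_sqrt (Nat.cast_nonneg d), one_pow]

theorem inv_sqrt_lt_one (hd : 2 ≤ d) : 1 / √(d : ℝ) < 1 := by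
  have h1 : (1 : ℝ) < d := by exact_mod_cast hd
  rw [div_lt_one (Real.sqrt_pos.mpr (by linarith)), Real.lt_sqrt zero_le_one]
  simpa using h1

theorem mubAngle_injective (hd : 2 ≤ d) : Function.Injective (mubAngle d) := by
  have h0 := inv_sqrt_pos hd
  have h1 := inv_sqrt_lt_one hd
  have hanti : StrictAnti (mubAngle d) := Fin.strictAnti_iff_succ_lt.mpr fun i => by
    fin_cases i <;> simp [mubAngle] at h0 h1 ⊢ <;> linarith
  exact hanti.injective

/-- The antipodal map on `M ∪ (-M)`. -/
instance : InvolutiveNeg (mubPoints M) where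
  neg x := ⟨-x.1, by
    obtain ⟨a, i, h | h⟩ := x.2
    · exact ⟨a, i, Or.inr (by rw [h])⟩
    · exact ⟨a, i, Or.inl (by rw [h, neg_neg])⟩⟩
  neg_neg x := Subtype.ext (neg_neg x.1)

@[simp]
theorem mubPoints_coe_neg (x : mubPoints M) : (-x).1 = -x.1 :=
  rfl

/-- The `i`-th vector of the `a`-th basis as a point of `M ∪ (-M)`. -/
noncomputable def basisPoint (M : Fin f → OrthonormalBasis (Fin d) ℝ (EuclideanSpace ℝ (Fin d)))
    (a : Fin f) (i : Fin d) : mubPoints M :=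
  ⟨M a i, a, i, Or.inl rfl⟩

@[simp]
theorem coe_basisPoint (a : Fin f) (i : Fin d) : (basisPoint M a i).1 = M a i :=
  rfl

/-- The index of a basis which contains the point up to sign; it is unique for mutually unbiased
bases in dimension at least two. -/
noncomputable def basisIndex (x : mubPoints M) : Fin f :=
  x.2.choose

theorem exists_eq_basisPoint (x : mubPoints M) :
    ∃ i, x = basisPoint M (basisIndex x) i ∨ x = -basisPoint M (basisIndex x) i := by
  obtain ⟨i, h | h⟩ := x.2.choose_spec
  · exact ⟨i, Or.inl (Subtype.ext h)⟩
  · exact ⟨i, Or.inr (Subtype.ext h)⟩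

theorem mubPoints_norm (x : mubPoints M) : ‖x.1‖ = 1 := by
  obtain ⟨i, h | h⟩ := exists_eq_basisPoint x <;> rw [h] <;> simp

theorem mubPoints_inner_self (x : mubPoints M) : ⟪x.1, x.1⟫_ℝ = 1 := by
  rw [real_inner_self_eq_norm_sq, mubPoints_norm, one_pow]

theorem mubPoints_inner_eq_one_iff {x y : mubPoints M} : ⟪x.1, y.1⟫_ℝ = 1 ↔ x = y := by
  rw [inner_eq_one_iff_of_norm_eq_one (mubPoints_norm x) (mubPoints_norm y), Subtype.ext_iff]

theorem mubPoints_inner_eq_neg_one_iff {x y : mubPoints M} : ⟪x.1, y.1⟫_ℝ = -1 ↔ x = -y := by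
  rw [← mubPoints_inner_eq_one_iff, mubPoints_coe_neg, inner_neg_right, neg_eq_iff_eq_neg]

theorem IsMUB.inner_sq (hM : IsMUB M) {a b : Fin f} (hab : a ≠ b) (i j : Fin d) :
    ⟪M a i, M b j⟫_ℝ ^ 2 = 1 / d := by
  rw [← inv_sqrt_sq, sq_eq_sq_iff_eq_or_eq_neg]
  exact hM a b hab i j

theorem inner_of_basisIndex_ne (hM : IsMUB M) {x y : mubPoints M}
    (h : basisIndex x ≠ basisIndex y) :
    ⟪x.1, y.1⟫_ℝ = 1 / √(d : ℝ) ∨ ⟪x.1, y.1⟫_ℝ = -(1 / √(d : ℝ)) := by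
  obtain ⟨i, hx⟩ := exists_eq_basisPoint x
  obtain ⟨j, hy⟩ := exists_eq_basisPoint y
  rw [← sq_eq_sq_iff_eq_or_eq_neg, inv_sqrt_sq, ← hM.inner_sq h i j]
  rcases hx with hx | hx <;> rcases hy with hy | hy <;>
    rw [congrArg Subtype.val hx, congrArg Subtype.val hy] <;> simp

theorem inner_sq_of_basisIndex_ne (hM : IsMUB M) {x y : mubPoints M}
    (h : basisIndex x ≠ basisIndex y) : ⟪x.1, y.1⟫_ℝ ^ 2 = 1 / d := by
  rw [← inv_sqrt_sq, sq_eq_sq_iff_eq_or_eq_neg]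
  exact inner_of_basisIndex_ne hM h

theorem inner_of_basisIndex_eq {x y : mubPoints M} (h : basisIndex x = basisIndex y) :
    ⟪x.1, y.1⟫_ℝ = 0 ∨ ⟪x.1, y.1⟫_ℝ = 1 ∨ ⟪x.1, y.1⟫_ℝ = -1 := by
  obtain ⟨i, hx⟩ := exists_eq_basisPoint x
  obtain ⟨j, hy⟩ := exists_eq_basisPoint y
  have hij := orthonormal_iff_ite.mp (M (basisIndex y)).orthonormal i j
  rw [h] at hx
  rcases hx with hx | hx <;> rcases hy with hy | hy <;>
    rw [congrArg Subtype.val hx, congrArg Subtype.val hy] <;>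
    by_cases e : i = j <;> simp [hij, e]

theorem basisIndex_eq_iff (hd : 2 ≤ d) (hM : IsMUB M) {x y : mubPoints M} :
    basisIndex x = basisIndex y ↔
      ⟪x.1, y.1⟫_ℝ = 0 ∨ ⟪x.1, y.1⟫_ℝ = 1 ∨ ⟪x.1, y.1⟫_ℝ = -1 := by
  refine ⟨inner_of_basisIndex_eq, fun h => ?_⟩
  by_contra hne
  have h0 := inv_sqrt_pos hd
  have h1 := inv_sqrt_lt_one hd
  rcases inner_of_basisIndex_ne hM hne with e | e <;> rw [e] at h <;>
    rcases h with h | h | h <;> linarith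

theorem basisIndex_basisPoint (hd : 2 ≤ d) (hM : IsMUB M) (a : Fin f) (i : Fin d) :
    basisIndex (basisPoint M a i) = a := by
  by_contra hne
  obtain ⟨j, h⟩ := exists_eq_basisPoint (basisPoint M a i)
  have hself := mubPoints_inner_self (basisPoint M a i)
  have hsq := hM.inner_sq (Ne.symm hne) i j
  have h1 : (1 : ℝ) / d < 1 := by
    rw [← inv_sqrt_sq]
    exact pow_lt_one₀ (inv_sqrt_pos hd).le (inv_sqrt_lt_one hd) two_ne_zero
  rcases h with h | h <;> rw [congrArg (fun x => ⟪(basisPoint M a i).1, x.1⟫_ℝ) h] at hself <;>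
    simp only [mubPoints_coe_neg, coe_basisPoint, inner_neg_right] at hself <;> nlinarith

@[simp]
theorem basisIndex_neg (hd : 2 ≤ d) (hM : IsMUB M) (x : mubPoints M) :
    basisIndex (-x) = basisIndex x := by
  rw [basisIndex_eq_iff hd hM, mubPoints_inner_eq_neg_one_iff.mpr rfl]
  simp

theorem exists_inner_eq_mubAngle (hM : IsMUB M) (x y : mubPoints M) :
    ∃ k, ⟪x.1, y.1⟫_ℝ = mubAngle d k := by
  by_cases h : basisIndex x = basisIndex y
  · rcases inner_of_basisIndex_eq h with h | h | h
    exacts [⟨2, h⟩, ⟨0, h⟩, ⟨4, h⟩]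
  · rcases inner_of_basisIndex_ne hM h with h | h
    exacts [⟨1, h⟩, ⟨3, h⟩]

theorem basisPoint_injective (a : Fin f) : Function.Injective (basisPoint M a) := fun _ _ h =>
  (M a).toBasis.injective (by simpa using congrArg Subtype.val h)

theorem basisPoint_ne_neg_basisPoint (a : Fin f) (i j : Fin d) :
    basisPoint M a i ≠ -basisPoint M a j := by
  rw [Ne, ← mubPoints_inner_eq_neg_one_iff, coe_basisPoint, coe_basisPoint,
    orthonormal_iff_ite.mp (M a).orthonormal]
  split_ifs <;> norm_num

theorem sum_basisIndex_eq (hd : 2 ≤ d) (hM : IsMUB M) {A : Type*} [AddCommMonoid A] (a : Fin f)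
    (F : mubPoints M → A) :
    ∑ w with basisIndex w = a, F w = ∑ i, (F (basisPoint M a i) + F (-basisPoint M a i)) := by
  let e : Fin d ⊕ Fin d ↪ mubPoints M :=
    ⟨Sum.elim (basisPoint M a) fun i => -basisPoint M a i,
      (basisPoint_injective a).sumElim (neg_injective.comp (basisPoint_injective a))
        (basisPoint_ne_neg_basisPoint a)⟩
  have hclass : ({w | basisIndex w = a} : Finset (mubPoints M)) = Finset.univ.map e := by
    ext w
    simp only [Finset.mem_filter_univ, Finset.mem_map, Finset.mem_univ, true_and, Sum.exists]
    constructor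
    · rintro rfl
      obtain ⟨i, h | h⟩ := exists_eq_basisPoint w
      exacts [Or.inl ⟨i, h.symm⟩, Or.inr ⟨i, h.symm⟩]
    · rintro (⟨i, rfl⟩ | ⟨i, rfl⟩) <;> simp [e, hd, hM, basisIndex_basisPoint]
  rw [hclass, Finset.sum_map, Fintype.sum_sum_type, Finset.sum_add_distrib]
  rfl

theorem sum_mubPoints (hd : 2 ≤ d) (hM : IsMUB M) {A : Type*} [AddCommMonoid A]
    (F : mubPoints M → A) :
    ∑ w, F w = ∑ a, ∑ i, (F (basisPoint M a i) + F (-basisPoint M a i)) := by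
  rw [← Finset.sum_fiberwise Finset.univ basisIndex]
  exact Finset.sum_congr rfl fun a _ => sum_basisIndex_eq hd hM a F

theorem card_mubPoints (hd : 2 ≤ d) (hM : IsMUB M) :
    (Fintype.card (mubPoints M) : ℝ) = 2 * d * f := by
  have h := sum_mubPoints hd hM fun _ => (1 : ℝ)
  simp only [Finset.sum_const, Finset.card_univ, Fintype.card_fin, nsmul_eq_mul, mul_one] at h
  rw [h]
  ring

theorem sum_basisIndex_eq_inner_mul_inner (hd : 2 ≤ d) (hM : IsMUB M) (a : Fin f)
    (u v : EuclideanSpace ℝ (Fin d)) :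
    ∑ w : mubPoints M with basisIndex w = a, ⟪u, w.1⟫_ℝ * ⟪v, w.1⟫_ℝ = 2 * ⟪u, v⟫_ℝ := by
  rw [sum_basisIndex_eq hd hM, ← (M a).sum_inner_mul_inner u v, Finset.mul_sum]
  refine Finset.sum_congr rfl fun i _ => ?_
  rw [real_inner_comm v (M a i)]
  simp only [coe_basisPoint, mubPoints_coe_neg, inner_neg_right]
  ring

theorem sum_inner_mul_inner_mubPoints (hd : 2 ≤ d) (hM : IsMUB M)
    (u v : EuclideanSpace ℝ (Fin d)) :
    ∑ w : mubPoints M, ⟪u, w.1⟫_ℝ * ⟪v, w.1⟫_ℝ = 2 * f * ⟪u, v⟫_ℝ := by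
  rw [← Finset.sum_fiberwise Finset.univ basisIndex,
    Finset.sum_congr rfl fun a _ => sum_basisIndex_eq_inner_mul_inner hd hM a u v,
    Finset.sum_const, Finset.card_univ, Fintype.card_fin, nsmul_eq_mul]
  ring

end MUBPoints

/-! ### The association scheme on `M ∪ (-M)` -/

/-- The five idempotents obtained from a chain of idempotents `p ≤ c ≤ s` together with an
idempotent `g ≤ 1 - s`, listed in the order which is `Q`-polynomial for `M ∪ (-M)`. -/
def chainIdempotents {A : Type*} [Ring A] (p c s g : A) : Fin 5 → A :=
  ![p, g, s - c, 1 - s - g, c - p]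

theorem completeOrthogonalIdempotents_chainIdempotents {A : Type*} [Ring A] {p c s g : A}
    (hp : p * p = p) (hc : c * c = c) (hs : s * s = s) (hg : g * g = g) (hpc : p * c = p)
    (hcp : c * p = p) (hcs : c * s = c) (hsc : s * c = c) (hgs : g * s = 0) (hsg : s * g = 0) :
    CompleteOrthogonalIdempotents (chainIdempotents p c s g) := by
  have hps : p * s = p := by rw [← hpc, mul_assoc, hcs]
  have hsp : s * p = p := by rw [← hcp, ← mul_assoc, hsc]
  have hcg : c * g = 0 := by rw [← hcs, mul_assoc, hsg, mul_zero]
  have hgc : g * c = 0 := by rw [← hsc, ← mul_assoc, hgs, zero_mul]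
  have hpg : p * g = 0 := by rw [← hps, mul_assoc, hsg, mul_zero]
  have hgp : g * p = 0 := by rw [← hsp, ← mul_assoc, hgs, zero_mul]
  refine ⟨⟨fun i => ?_, fun i j hij => ?_⟩, ?_⟩
  · fin_cases i <;> simp [IsIdempotentElem, chainIdempotents, mul_sub, sub_mul, *]
  · fin_cases i <;> fin_cases j <;>
      first
        | exact absurd rfl hij
        | simp [chainIdempotents, mul_sub, sub_mul, hp, hc, hs, hg, hpc, hcp, hcs, hsc, hgs, hsg,
            hps, hsp, hcg, hgc, hpg, hgp]
  · simp only [chainIdempotents, Fin.sum_univ_five, Matrix.cons_val]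
    abel

section MUBScheme

variable {d f : ℕ} {M : Fin f → OrthonormalBasis (Fin d) ℝ (EuclideanSpace ℝ (Fin d))}

theorem mubRel_partition (hd : 2 ≤ d) (hM : IsMUB M) (x y : mubPoints M) :
    ∃! k, mubRel M k x y := by
  obtain ⟨k, hk⟩ := exists_inner_eq_mubAngle hM x y
  exact ⟨k, hk, fun l hl => mubAngle_injective hd (hl.symm.trans hk)⟩

theorem mubRel_nonempty (hd : 2 ≤ d) (hf : 2 ≤ f) (hM : IsMUB M) (k : Fin 5) :
    ∃ x y, mubRel M k x y := by
  let x := basisPoint M ⟨0, by lia⟩ ⟨0, by lia⟩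
  let x' := basisPoint M ⟨0, by lia⟩ ⟨1, by lia⟩
  let y := basisPoint M ⟨1, by lia⟩ ⟨0, by lia⟩
  have hneg (u v : mubPoints M) : ⟪u.1, (-v).1⟫_ℝ = -⟪u.1, v.1⟫_ℝ := inner_neg_right _ _
  have hxx : ⟪x.1, x.1⟫_ℝ = 1 := mubPoints_inner_self x
  have hxx' : ⟪x.1, x'.1⟫_ℝ = 0 := (M _).orthonormal.2 (by simp)
  have hxy : ⟪x.1, y.1⟫_ℝ = 1 / √(d : ℝ) ∨ ⟪x.1, y.1⟫_ℝ = -(1 / √(d : ℝ)) :=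
    hM _ _ (by simp) _ _
  unfold mubRel
  fin_cases k
  · exact ⟨x, x, hxx⟩
  · rcases hxy with h | h
    · exact ⟨x, y, h⟩
    · exact ⟨x, -y, by rw [hneg, h, neg_neg]; rfl⟩
  · exact ⟨x, x', hxx'⟩
  · rcases hxy with h | h
    · exact ⟨x, -y, by rw [hneg, h]; rfl⟩
    · exact ⟨x, y, h⟩
  · exact ⟨x, -x, by rw [hneg, hxx]; rfl⟩

/-- The Gram matrix of `M ∪ (-M)`. -/
noncomputable def mubGram (M : Fin f → OrthonormalBasis (Fin d) ℝ (EuclideanSpace ℝ (Fin d))) :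
    Matrix (mubPoints M) (mubPoints M) ℝ :=
  Matrix.of fun x y => ⟪x.1, y.1⟫_ℝ

/-- The adjacency matrix of the relation of lying in the same basis up to sign. -/
noncomputable def mubClassMatrix
    (M : Fin f → OrthonormalBasis (Fin d) ℝ (EuclideanSpace ℝ (Fin d))) :
    Matrix (mubPoints M) (mubPoints M) ℝ :=
  Matrix.of fun x y => if basisIndex x = basisIndex y then 1 else 0

/-- The permutation matrix of `x ↦ -x` on `M ∪ (-M)`. -/
noncomputable def mubNegMatrix
    (M : Fin f → OrthonormalBasis (Fin d) ℝ (EuclideanSpace ℝ (Fin d))) :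
    Matrix (mubPoints M) (mubPoints M) ℝ :=
  Matrix.of fun x y => if x = -y then 1 else 0

/-- The all-ones matrix on `M ∪ (-M)`. -/
def mubOnes (M : Fin f → OrthonormalBasis (Fin d) ℝ (EuclideanSpace ℝ (Fin d))) :
    Matrix (mubPoints M) (mubPoints M) ℝ :=
  Matrix.of fun _ _ => 1

theorem mubNegMatrix_mul_apply (B : Matrix (mubPoints M) (mubPoints M) ℝ) (x y : mubPoints M) :
    (mubNegMatrix M * B) x y = B (-x) y := by
  simp [Matrix.mul_apply, mubNegMatrix, ← neg_eq_iff_eq_neg]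

theorem mul_mubNegMatrix_apply (B : Matrix (mubPoints M) (mubPoints M) ℝ) (x y : mubPoints M) :
    (B * mubNegMatrix M) x y = B x (-y) := by
  simp [Matrix.mul_apply, mubNegMatrix]

theorem mubNegMatrix_mul_self : mubNegMatrix M * mubNegMatrix M = 1 := by
  ext x y
  rw [mubNegMatrix_mul_apply]
  simp [mubNegMatrix, Matrix.one_apply]

theorem mubNegMatrix_mul_mubClassMatrix (hd : 2 ≤ d) (hM : IsMUB M) :
    mubNegMatrix M * mubClassMatrix M = mubClassMatrix M := by
  ext x y
  simp [mubNegMatrix_mul_apply, mubClassMatrix, basisIndex_neg hd hM]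

theorem mubClassMatrix_mul_mubNegMatrix (hd : 2 ≤ d) (hM : IsMUB M) :
    mubClassMatrix M * mubNegMatrix M = mubClassMatrix M := by
  ext x y
  simp [mul_mubNegMatrix_apply, mubClassMatrix, basisIndex_neg hd hM]

theorem mubNegMatrix_mul_mubGram : mubNegMatrix M * mubGram M = -mubGram M := by
  ext x y
  simp [mubNegMatrix_mul_apply, mubGram]

theorem mubGram_mul_mubNegMatrix : mubGram M * mubNegMatrix M = -mubGram M := by
  ext x y
  simp [mul_mubNegMatrix_apply, mubGram]

theorem mubGram_mul_self (hd : 2 ≤ d) (hM : IsMUB M) :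
    mubGram M * mubGram M = (2 * f : ℝ) • mubGram M := by
  ext x y
  simp only [Matrix.mul_apply, mubGram, Matrix.of_apply, Matrix.smul_apply, smul_eq_mul,
    ← sum_inner_mul_inner_mubPoints hd hM, real_inner_comm _ y.1]

theorem card_basisIndex_eq (hd : 2 ≤ d) (hM : IsMUB M) (a : Fin f) :
    ∑ w : mubPoints M, (if basisIndex w = a then 1 else 0) = (2 * d : ℝ) := by
  rw [← Finset.sum_filter, sum_basisIndex_eq hd hM, Finset.sum_const, Finset.card_univ,
    Fintype.card_fin, nsmul_eq_mul, one_add_one_eq_two, mul_comm]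

theorem mubClassMatrix_mul_self (hd : 2 ≤ d) (hM : IsMUB M) :
    mubClassMatrix M * mubClassMatrix M = (2 * d : ℝ) • mubClassMatrix M := by
  ext x y
  simp only [Matrix.mul_apply, mubClassMatrix, Matrix.of_apply, Matrix.smul_apply, smul_eq_mul]
  rw [← card_basisIndex_eq hd hM (basisIndex y), Finset.sum_mul]
  refine Finset.sum_congr rfl fun w _ => ?_
  by_cases h : basisIndex w = basisIndex y <;> simp [h]

theorem mubClassMatrix_mul_mubOnes (hd : 2 ≤ d) (hM : IsMUB M) :
    mubClassMatrix M * mubOnes M = (2 * d : ℝ) • mubOnes M := by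
  ext x y
  simp only [Matrix.mul_apply, mubClassMatrix, mubOnes, Matrix.of_apply, Matrix.smul_apply,
    smul_eq_mul, mul_one, eq_comm (a := basisIndex x)]
  exact card_basisIndex_eq hd hM (basisIndex x)

theorem mubOnes_mul_mubClassMatrix (hd : 2 ≤ d) (hM : IsMUB M) :
    mubOnes M * mubClassMatrix M = (2 * d : ℝ) • mubOnes M := by
  ext x y
  simp only [Matrix.mul_apply, mubClassMatrix, mubOnes, Matrix.of_apply, Matrix.smul_apply,
    smul_eq_mul, mul_one, one_mul]
  exact card_basisIndex_eq hd hM (basisIndex y)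

theorem mubOnes_mul_self (hd : 2 ≤ d) (hM : IsMUB M) :
    mubOnes M * mubOnes M = (2 * d * f : ℝ) • mubOnes M := by
  ext x y
  rw [← card_mubPoints hd hM]
  simp [Matrix.mul_apply, mubOnes]

open Classical in
theorem one_apply_eq_ite_inner (x y : mubPoints M) :
    (1 : Matrix (mubPoints M) (mubPoints M) ℝ) x y = if ⟪x.1, y.1⟫_ℝ = 1 then 1 else 0 := by
  simp only [Matrix.one_apply, mubPoints_inner_eq_one_iff]

open Classical in
theorem mubNegMatrix_apply_eq_ite_inner (x y : mubPoints M) :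
    mubNegMatrix M x y = if ⟪x.1, y.1⟫_ℝ = -1 then 1 else 0 := by
  simp only [mubNegMatrix, Matrix.of_apply, mubPoints_inner_eq_neg_one_iff]

open Classical in
theorem mubClassMatrix_apply_eq_ite_inner (hd : 2 ≤ d) (hM : IsMUB M) (x y : mubPoints M) :
    mubClassMatrix M x y =
      if ⟪x.1, y.1⟫_ℝ = 0 ∨ ⟪x.1, y.1⟫_ℝ = 1 ∨ ⟪x.1, y.1⟫_ℝ = -1 then 1 else 0 := by
  simp only [mubClassMatrix, Matrix.of_apply, basisIndex_eq_iff hd hM]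

theorem mubGram_hadamard_mubOnes : mubGram M ⊙ mubOnes M = mubGram M := by
  ext x y
  simp [mubOnes]

theorem mubGram_hadamard_one : mubGram M ⊙ 1 = 1 := by
  ext x y
  by_cases h : x = y <;> simp [mubGram, Matrix.one_apply, h, mubPoints_norm]

theorem mubGram_hadamard_mubNegMatrix : mubGram M ⊙ mubNegMatrix M = -mubNegMatrix M := by
  ext x y
  by_cases h : x = -y <;> simp [mubGram, mubNegMatrix, h, mubPoints_norm]

theorem mubGram_hadamard_mubClassMatrix (hd : 2 ≤ d) (hM : IsMUB M) :
    mubGram M ⊙ mubClassMatrix M = 1 - mubNegMatrix M := by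
  ext x y
  rw [Matrix.hadamard_apply, Matrix.sub_apply, one_apply_eq_ite_inner,
    mubNegMatrix_apply_eq_ite_inner, mubClassMatrix_apply_eq_ite_inner hd hM, mubGram,
    Matrix.of_apply]
  generalize ⟪x.1, y.1⟫_ℝ = t
  grind

theorem mubGram_hadamard_self (hd : 2 ≤ d) (hM : IsMUB M) :
    mubGram M ⊙ mubGram M =
      (d : ℝ)⁻¹ • (mubOnes M - mubClassMatrix M) + 1 + mubNegMatrix M := by
  ext x y
  have hsq : basisIndex x ≠ basisIndex y → ⟪x.1, y.1⟫_ℝ ^ 2 = 1 / d :=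
    inner_sq_of_basisIndex_ne hM
  rw [Ne, basisIndex_eq_iff hd hM] at hsq
  simp only [Matrix.hadamard_apply, Matrix.add_apply, Matrix.sub_apply, Matrix.smul_apply,
    smul_eq_mul, one_apply_eq_ite_inner, mubNegMatrix_apply_eq_ite_inner,
    mubClassMatrix_apply_eq_ite_inner hd hM, mubGram, mubOnes, Matrix.of_apply]
  generalize ⟪x.1, y.1⟫_ℝ = t at hsq ⊢
  grind

/-- The primitive idempotents of the scheme on `M ∪ (-M)`, in the `Q`-polynomial ordering. -/
noncomputable def mubIdempotent
    (M : Fin f → OrthonormalBasis (Fin d) ℝ (EuclideanSpace ℝ (Fin d))) :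
    Fin 5 → Matrix (mubPoints M) (mubPoints M) ℝ :=
  chainIdempotents ((2 * d * f : ℝ)⁻¹ • mubOnes M) ((2 * d : ℝ)⁻¹ • mubClassMatrix M)
    ((2 : ℝ)⁻¹ • (1 + mubNegMatrix M)) ((2 * f : ℝ)⁻¹ • mubGram M)

theorem completeOrthogonalIdempotents_mubIdempotent (hd : 2 ≤ d) (hf : 2 ≤ f) (hM : IsMUB M) :
    CompleteOrthogonalIdempotents (mubIdempotent M) := by
  have hd0 : (d : ℝ) ≠ 0 := by exact_mod_cast (by lia : d ≠ 0)
  have hf0 : (f : ℝ) ≠ 0 := by exact_mod_cast (by lia : f ≠ 0)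
  apply completeOrthogonalIdempotents_chainIdempotents <;>
    simp only [smul_mul_smul_comm, mul_add, add_mul, mul_one, one_mul, mubOnes_mul_self hd hM,
      mubClassMatrix_mul_self hd hM, mubNegMatrix_mul_self, mubGram_mul_self hd hM,
      mubOnes_mul_mubClassMatrix hd hM, mubClassMatrix_mul_mubOnes hd hM,
      mubClassMatrix_mul_mubNegMatrix hd hM, mubNegMatrix_mul_mubClassMatrix hd hM,
      mubGram_mul_mubNegMatrix, mubNegMatrix_mul_mubGram] <;>
    match_scalars <;> field_simp <;> ring

theorem mem_boseMesner_mubRel (hd : 2 ≤ d) (hM : IsMUB M) (h : ℝ → ℝ)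
    {B : Matrix (mubPoints M) (mubPoints M) ℝ} (hB : ∀ x y, B x y = h ⟪x.1, y.1⟫_ℝ) :
    B ∈ boseMesner (mubRel M) :=
  mem_boseMesner_of_apply_eq (mubRel_partition hd hM) (fun k => h (mubAngle d k))
    fun _ x y hk => (hB x y).trans (congrArg h hk)

open Classical in
theorem mubIdempotent_mem_boseMesner (hd : 2 ≤ d) (hM : IsMUB M) (i : Fin 5) :
    mubIdempotent M i ∈ boseMesner (mubRel M) := by
  have h1 : (1 : Matrix (mubPoints M) (mubPoints M) ℝ) ∈ boseMesner (mubRel M) :=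
    mem_boseMesner_mubRel hd hM (fun t => if t = 1 then 1 else 0) one_apply_eq_ite_inner
  have hA : mubNegMatrix M ∈ boseMesner (mubRel M) :=
    mem_boseMesner_mubRel hd hM (fun t => if t = -1 then 1 else 0)
      mubNegMatrix_apply_eq_ite_inner
  have hC : mubClassMatrix M ∈ boseMesner (mubRel M) :=
    mem_boseMesner_mubRel hd hM (fun t => if t = 0 ∨ t = 1 ∨ t = -1 then 1 else 0)
      (mubClassMatrix_apply_eq_ite_inner hd hM)
  have hJ : mubOnes M ∈ boseMesner (mubRel M) :=
    mem_boseMesner_mubRel hd hM (fun _ => 1) fun x y => rfl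
  have hG : mubGram M ∈ boseMesner (mubRel M) :=
    mem_boseMesner_mubRel hd hM id fun x y => rfl
  have hS := Submodule.smul_mem _ (2⁻¹ : ℝ) (Submodule.add_mem _ h1 hA)
  have hC' := Submodule.smul_mem _ (2 * d : ℝ)⁻¹ hC
  have hJ' := Submodule.smul_mem _ (2 * d * f : ℝ)⁻¹ hJ
  have hG' := Submodule.smul_mem _ (2 * f : ℝ)⁻¹ hG
  fin_cases i
  exacts [hJ', hG', Submodule.sub_mem _ hS hC',
    Submodule.sub_mem _ (Submodule.sub_mem _ h1 hS) hG', Submodule.sub_mem _ hC' hJ']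

theorem mubIdempotent_trace_pos (hd : 2 ≤ d) (hf : 2 ≤ f) (i : Fin 5) :
    0 < (mubIdempotent M i).trace := by
  have hd0 : 0 < (d : ℝ)⁻¹ := inv_pos.mpr (by exact_mod_cast (by lia : 0 < d))
  have hf0 : 0 < (f : ℝ)⁻¹ := inv_pos.mpr (by exact_mod_cast (by lia : 0 < f))
  have hdinv : (d : ℝ)⁻¹ ≤ 2⁻¹ := inv_anti₀ two_pos (by exact_mod_cast hd)
  have hfinv : (f : ℝ)⁻¹ ≤ 2⁻¹ := inv_anti₀ two_pos (by exact_mod_cast hf)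
  have hne : (Finset.univ : Finset (mubPoints M)).Nonempty :=
    ⟨basisPoint M ⟨0, by lia⟩ ⟨0, by lia⟩, Finset.mem_univ _⟩
  refine Finset.sum_pos (fun x _ => ?_) hne
  have hx : x ≠ -x := by
    rw [Ne, ← mubPoints_inner_eq_neg_one_iff, mubPoints_inner_self]
    norm_num
  fin_cases i <;> simp [mubIdempotent, chainIdempotents, mubOnes, mubClassMatrix, mubNegMatrix,
    mubGram, hx, mubPoints_norm] <;> nlinarith

/-- The Krein numbers `q_{1j}^k` of the scheme on `M ∪ (-M)`. -/
noncomputable def mubKrein (d f : ℕ) : Fin 5 → Fin 5 → ℝ :=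
  ![![0, 1, 0, 0, 0],
    ![d, 0, d / f, 0, 0],
    ![0, d - 1, 0, d - 1, 0],
    ![0, 0, d - d / f, 0, d],
    ![0, 0, 0, 1, 0]]

theorem mubIdempotent_one_hadamard (hd : 2 ≤ d) (hf : 2 ≤ f) (hM : IsMUB M) (j : Fin 5) :
    mubIdempotent M 1 ⊙ mubIdempotent M j =
      ∑ k, ((2 * d * f : ℝ)⁻¹ * mubKrein d f j k) • mubIdempotent M k := by
  have hd0 : (d : ℝ) ≠ 0 := by exact_mod_cast (by lia : d ≠ 0)
  have hf0 : (f : ℝ) ≠ 0 := by exact_mod_cast (by lia : f ≠ 0)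
  have hadamard_sub (A B C : Matrix (mubPoints M) (mubPoints M) ℝ) :
      A ⊙ (B - C) = A ⊙ B - A ⊙ C := by
    ext x y
    exact mul_sub _ _ _
  fin_cases j <;>
    simp only [mubIdempotent, chainIdempotents, mubKrein, Fin.sum_univ_five, Matrix.cons_val,
      Fin.zero_eta, Fin.mk_one, Fin.reduceFinMk, Matrix.smul_hadamard, Matrix.hadamard_smul,
      Matrix.hadamard_add, hadamard_sub, mubGram_hadamard_mubOnes, mubGram_hadamard_one,
      mubGram_hadamard_mubNegMatrix, mubGram_hadamard_mubClassMatrix hd hM,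
      mubGram_hadamard_self hd hM] <;>
    match_scalars <;> field_simp <;> ring

theorem isPrimitiveIdempotentOrdering_mubIdempotent (hd : 2 ≤ d) (hf : 2 ≤ f) (hM : IsMUB M) :
    IsPrimitiveIdempotentOrdering (mubRel M) (mubIdempotent M) where
  mem_boseMesner := mubIdempotent_mem_boseMesner hd hM
  zero_eq := by
    rw [card_mubPoints hd hM]
    ext x y
    simp [mubIdempotent, chainIdempotents, mubOnes]
  idem := (completeOrthogonalIdempotents_mubIdempotent hd hf hM).idem
  orth _ _ h := (completeOrthogonalIdempotents_mubIdempotent hd hf hM).ortho h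
  sum_eq_one := (completeOrthogonalIdempotents_mubIdempotent hd hf hM).complete
  ne_zero i h := by
    have htrace := mubIdempotent_trace_pos (M := M) hd hf i
    rw [h, Matrix.trace_zero] at htrace
    exact lt_irrefl _ htrace

theorem isSymmetricAssociationScheme_mubRel (hd : 2 ≤ d) (hf : 2 ≤ f) (hM : IsMUB M) :
    IsSymmetricAssociationScheme (mubRel M) :=
  have hE := isPrimitiveIdempotentOrdering_mubIdempotent hd hf hM
  isSymmetricAssociationScheme_of_orthogonalIdempotents hE.orthogonalIdempotents
    hE.mem_boseMesner hE.ne_zero (mubRel_nonempty hd hf hM) (mubRel_partition hd hM)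
    (fun _ _ => mubPoints_inner_eq_one_iff) fun _ _ _ h => (real_inner_comm _ _).trans h

theorem kreinNumber_mubIdempotent (hd : 2 ≤ d) (hf : 2 ≤ f) (hM : IsMUB M) (j k : Fin 5) :
    kreinNumber (mubIdempotent M) 1 j k = mubKrein d f j k := by
  have hE := isPrimitiveIdempotentOrdering_mubIdempotent hd hf hM
  have hN := (isSymmetricAssociationScheme_mubRel hd hf hM).card_ne_zero
  rw [kreinNumber_eq_of_hadamard_eq hE.orthogonalIdempotents
    (mubIdempotent_one_hadamard hd hf hM j) (hE.trace_ne_zero k), ← card_mubPoints hd hM,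
    mul_inv_cancel_left₀ hN]

theorem isQPolynomial_mubIdempotent (hd : 2 ≤ d) (hf : 2 ≤ f) (hM : IsMUB M) :
    IsQPolynomial (mubIdempotent M) := by
  have hd1 : (1 : ℝ) < d := by exact_mod_cast hd
  have hf1 : (1 : ℝ) < f := by exact_mod_cast hf
  have hd0 : d ≠ 0 := by lia
  have hf0 : f ≠ 0 := by lia
  have hb : (d : ℝ) - 1 ≠ 0 := by linarith
  have hc : (d : ℝ) - d / f ≠ 0 := (sub_pos.mpr (div_lt_self (by linarith) hf1)).ne'
  intro j k
  rw [kreinNumber_mubIdempotent hd hf hM]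
  fin_cases j <;> fin_cases k <;> simp [mubKrein, hb, hc, hd0, hf0]

theorem isQAntipodal_mubIdempotent (hd : 2 ≤ d) (hf : 2 ≤ f) (hM : IsMUB M) :
    IsQAntipodal (mubIdempotent M) := by
  intro j hj
  simp only [kreinB, kreinC, kreinNumber_mubIdempotent hd hf hM]
  fin_cases j <;> simp [mubKrein, Fin.rev] at hj ⊢

theorem isQBipartite_mubIdempotent (hd : 2 ≤ d) (hf : 2 ≤ f) (hM : IsMUB M) :
    IsQBipartite (mubIdempotent M) := by
  intro j
  rw [kreinA, kreinNumber_mubIdempotent hd hf hM]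
  fin_cases j <;> rfl

theorem rank_mubIdempotent_one (hd : 2 ≤ d) (hf : 2 ≤ f) (hM : IsMUB M) :
    (mubIdempotent M 1).rank = d := by
  have hf0 : (f : ℝ) ≠ 0 := by exact_mod_cast (by lia : f ≠ 0)
  have hdiag (x : mubPoints M) : mubIdempotent M 1 x x = (2 * f : ℝ)⁻¹ := by
    simp [mubIdempotent, chainIdempotents, mubGram, mubPoints_norm]
  have htrace : (mubIdempotent M 1).trace = d := by
    simp only [Matrix.trace, Matrix.diag_apply, hdiag, Finset.sum_const, Finset.card_univ,
      nsmul_eq_mul, card_mubPoints hd hM]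
    field_simp
  have hidem := (isPrimitiveIdempotentOrdering_mubIdempotent hd hf hM).idem 1
  exact_mod_cast (rank_eq_trace_of_isIdempotentElem hidem).trans htrace

theorem mem_qAntipodalClass_mubIdempotent (hd : 2 ≤ d) {x y : mubPoints M} :
    y ∈ qAntipodalClass (mubIdempotent M) x ↔ basisIndex x = basisIndex y := by
  have hd0 : d ≠ 0 := by lia
  have hE : mubIdempotent M 0 + mubIdempotent M (Fin.last 4) =
      (2 * d : ℝ)⁻¹ • mubClassMatrix M :=
    add_sub_cancel _ _
  rw [qAntipodalClass, Set.mem_ofPred_eq, hE]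
  simp [mubClassMatrix, hd0]

theorem numQAntipodalClasses_mubIdempotent (hd : 2 ≤ d) (hM : IsMUB M) :
    numQAntipodalClasses (mubIdempotent M) = f := by
  let pt (a : Fin f) : mubPoints M := basisPoint M a ⟨0, by lia⟩
  have hpt (a) : basisIndex (pt a) = a := basisIndex_basisPoint hd hM a _
  have hclass (x : mubPoints M) : qAntipodalClass (mubIdempotent M) x =
      {y | basisIndex x = basisIndex y} := by
    ext y
    exact mem_qAntipodalClass_mubIdempotent hd
  have hrange : Set.range (qAntipodalClass (mubIdempotent M)) =
      Set.range fun a : Fin f => {y : mubPoints M | a = basisIndex y} := by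
    rw [funext hclass]
    exact Function.Surjective.range_comp (fun a => ⟨pt a, hpt a⟩)
      fun a : Fin f => {y : mubPoints M | a = basisIndex y}
  have hinj : Function.Injective fun a : Fin f => {y : mubPoints M | a = basisIndex y} := by
    intro a b hab
    have hmem : pt b ∈ {y : mubPoints M | a = basisIndex y} := by
      rw [show {y : mubPoints M | a = basisIndex y} = _ from hab]
      exact (hpt b).symm
    exact (show a = _ from hmem).trans (hpt b)
  rw [numQAntipodalClasses, hrange, ← Set.image_univ, Set.ncard_image_of_injective _ hinj,
    Set.ncard_univ, Nat.card_eq_fintype_card, Fintype.card_fin]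

end MUBScheme

/-! ### Fourth moments -/

section FourthMoment

variable {d f : ℕ} {M : Fin f → OrthonormalBasis (Fin d) ℝ (EuclideanSpace ℝ (Fin d))}

/-- The fourth moment of the points of `M ∪ (-M)`, as a symmetric 4-linear form on `ℝ^d`. -/
noncomputable def fourthMoment
    (M : Fin f → OrthonormalBasis (Fin d) ℝ (EuclideanSpace ℝ (Fin d)))
    (u v y z : EuclideanSpace ℝ (Fin d)) : ℝ :=
  ∑ w : mubPoints M, ⟪u, w.1⟫_ℝ * ⟪v, w.1⟫_ℝ * ⟪y, w.1⟫_ℝ * ⟪z, w.1⟫_ℝ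

theorem fourthMoment_swap (u v y z : EuclideanSpace ℝ (Fin d)) :
    fourthMoment M u v y z = fourthMoment M v u y z :=
  Finset.sum_congr rfl fun _ _ => by ring

theorem fourthMoment_rotate (u v y z : EuclideanSpace ℝ (Fin d)) :
    fourthMoment M u v y z = fourthMoment M v y z u :=
  Finset.sum_congr rfl fun _ _ => by ring

theorem fourthMoment_eq_sum (b : OrthonormalBasis (Fin d) ℝ (EuclideanSpace ℝ (Fin d)))
    (u v y z : EuclideanSpace ℝ (Fin d)) :
    fourthMoment M u v y z = ∑ k, ⟪u, b k⟫_ℝ * fourthMoment M (b k) v y z := by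
  simp only [fourthMoment, Finset.mul_sum]
  rw [Finset.sum_comm]
  refine Finset.sum_congr rfl fun w _ => ?_
  rw [← b.sum_inner_mul_inner u w.1, Finset.sum_mul, Finset.sum_mul, Finset.sum_mul]
  exact Finset.sum_congr rfl fun k _ => by ring

theorem inner_sq_eq (hd : 2 ≤ d) (hM : IsMUB M) (x w : mubPoints M) :
    ⟪x.1, w.1⟫_ℝ ^ 2 = (d : ℝ)⁻¹ - (d : ℝ)⁻¹ * (if basisIndex w = basisIndex x then 1 else 0) +
      (if w = x then 1 else 0) + if w = -x then 1 else 0 := by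
  have h := congrFun₂ (mubGram_hadamard_self hd hM) w x
  simp only [mubGram, mubOnes, mubClassMatrix, mubNegMatrix, Matrix.hadamard_apply,
    Matrix.add_apply, Matrix.smul_apply, Matrix.sub_apply, Matrix.of_apply, Matrix.one_apply,
    smul_eq_mul] at h
  rw [real_inner_comm, sq, h]
  ring

theorem fourthMoment_self_self (hd : 2 ≤ d) (hM : IsMUB M) (x : mubPoints M)
    (u v : EuclideanSpace ℝ (Fin d)) :
    fourthMoment M x x u v =
      2 * ⟪x.1, u⟫_ℝ * ⟪x.1, v⟫_ℝ + 2 * (f - 1) / d * ⟪u, v⟫_ℝ := by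
  have hterm (w : mubPoints M) : ⟪x.1, w.1⟫_ℝ * ⟪x.1, w.1⟫_ℝ * ⟪u, w.1⟫_ℝ * ⟪v, w.1⟫_ℝ =
      (d : ℝ)⁻¹ * (⟪u, w.1⟫_ℝ * ⟪v, w.1⟫_ℝ) -
        (d : ℝ)⁻¹ * (if basisIndex w = basisIndex x then ⟪u, w.1⟫_ℝ * ⟪v, w.1⟫_ℝ else 0) +
        (if w = x then ⟪u, w.1⟫_ℝ * ⟪v, w.1⟫_ℝ else 0) +
        if w = -x then ⟪u, w.1⟫_ℝ * ⟪v, w.1⟫_ℝ else 0 := by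
    rw [← sq, inner_sq_eq hd hM]
    simp only [← mul_boole _ (⟪u, w.1⟫_ℝ * ⟪v, w.1⟫_ℝ)]
    ring
  simp only [fourthMoment, hterm, Finset.sum_add_distrib, Finset.sum_sub_distrib,
    ← Finset.mul_sum, ← Finset.sum_filter (fun w => basisIndex w = basisIndex x),
    sum_inner_mul_inner_mubPoints hd hM, sum_basisIndex_eq_inner_mul_inner hd hM,
    Finset.sum_ite_eq', Finset.mem_univ, if_true, mubPoints_coe_neg, inner_neg_right,
    real_inner_comm x.1]
  ring

/-- The deviation of the fourth moment from the isotropic 4-linear form. -/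
noncomputable def momentDefect
    (M : Fin f → OrthonormalBasis (Fin d) ℝ (EuclideanSpace ℝ (Fin d)))
    (u v y z : EuclideanSpace ℝ (Fin d)) : ℝ :=
  fourthMoment M u v y z - ⟪y, z⟫_ℝ * ⟪u, v⟫_ℝ - ⟪u, y⟫_ℝ * ⟪v, z⟫_ℝ - ⟪u, z⟫_ℝ * ⟪v, y⟫_ℝ

theorem momentDefect_self_self (hd : 2 ≤ d) (hM : IsMUB M) (hf : (f : ℝ) = d / 2 + 1)
    (x : mubPoints M) (u v : EuclideanSpace ℝ (Fin d)) : momentDefect M x x u v = 0 := by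
  have hd0 : (d : ℝ) ≠ 0 := by exact_mod_cast (by lia : d ≠ 0)
  rw [momentDefect, fourthMoment_self_self hd hM, mubPoints_inner_self, hf]
  field_simp
  ring

theorem sum_momentDefect_basis (hd : 2 ≤ d) (hM : IsMUB M) (hf : (f : ℝ) = d / 2 + 1)
    (b : OrthonormalBasis (Fin d) ℝ (EuclideanSpace ℝ (Fin d)))
    (y z : EuclideanSpace ℝ (Fin d)) : ∑ i, momentDefect M (b i) (b i) y z = 0 := by
  have hsq (w : mubPoints M) : ∑ i, ⟪b i, w.1⟫_ℝ * ⟪b i, w.1⟫_ℝ = 1 := by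
    simp only [← sq, b.sum_sq_inner_right, mubPoints_norm, one_pow]
  have hmoment : ∑ i, fourthMoment M (b i) (b i) y z = 2 * f * ⟪y, z⟫_ℝ := by
    simp only [fourthMoment]
    rw [Finset.sum_comm, ← sum_inner_mul_inner_mubPoints hd hM]
    refine Finset.sum_congr rfl fun w _ => ?_
    simp only [← Finset.sum_mul, hsq, one_mul]
  have hself (i) : ⟪b i, b i⟫_ℝ = 1 := by rw [real_inner_self_eq_norm_sq, b.norm_eq_one, one_pow]
  have hyz : ∑ i, ⟪b i, y⟫_ℝ * ⟪b i, z⟫_ℝ = ⟪y, z⟫_ℝ := by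
    simp only [← b.sum_inner_mul_inner y z, real_inner_comm]
  have hzy : ∑ i, ⟪b i, z⟫_ℝ * ⟪b i, y⟫_ℝ = ⟪y, z⟫_ℝ := by
    simp only [← hyz, mul_comm]
  simp only [momentDefect, Finset.sum_sub_distrib, hmoment, hyz, hzy, hself, Finset.sum_const,
    Finset.card_univ, Fintype.card_fin, nsmul_eq_mul, mul_one, hf]
  ring

/-- The vector which represents the linear form `momentDefect M u · y z`. -/
noncomputable def momentDefectVector
    (M : Fin f → OrthonormalBasis (Fin d) ℝ (EuclideanSpace ℝ (Fin d)))
    (y z u : EuclideanSpace ℝ (Fin d)) : EuclideanSpace ℝ (Fin d) :=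
  ∑ w : mubPoints M, (⟪u, w.1⟫_ℝ * ⟪y, w.1⟫_ℝ * ⟪z, w.1⟫_ℝ) • w.1 -
    ⟪y, z⟫_ℝ • u - ⟪u, y⟫_ℝ • z - ⟪u, z⟫_ℝ • y

theorem inner_momentDefectVector (y z u v : EuclideanSpace ℝ (Fin d)) :
    ⟪momentDefectVector M y z u, v⟫_ℝ = momentDefect M u v y z := by
  rw [real_inner_comm, momentDefectVector, momentDefect, fourthMoment, real_inner_comm v u]
  simp only [inner_sub_right, inner_sum, real_inner_smul_right]
  congr 3
  exact Finset.sum_congr rfl fun w _ => by ring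

theorem momentDefect_swap (u v y z : EuclideanSpace ℝ (Fin d)) :
    momentDefect M u v y z = momentDefect M v u y z := by
  rw [momentDefect, momentDefect, fourthMoment_swap, real_inner_comm u v]
  ring

theorem momentDefect_rotate (u v y z : EuclideanSpace ℝ (Fin d)) :
    momentDefect M u v y z = momentDefect M y u v z := by
  have hperm : fourthMoment M u v y z = fourthMoment M y u v z :=
    Finset.sum_congr rfl fun _ _ => by ring
  rw [momentDefect, momentDefect, hperm, real_inner_comm u y, real_inner_comm v y]
  ring

theorem norm_sq_momentDefectVector (y z u : EuclideanSpace ℝ (Fin d)) :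
    ‖momentDefectVector M y z u‖ ^ 2 =
      ∑ w : mubPoints M,
          ⟪y, w.1⟫_ℝ * ⟪z, w.1⟫_ℝ * (⟪u, w.1⟫_ℝ * ⟪momentDefectVector M y z u, w.1⟫_ℝ) -
        ⟪y, z⟫_ℝ * ⟪u, momentDefectVector M y z u⟫_ℝ -
        ⟪u, y⟫_ℝ * ⟪momentDefectVector M y z u, z⟫_ℝ -
        ⟪u, z⟫_ℝ * ⟪momentDefectVector M y z u, y⟫_ℝ := by
  rw [← real_inner_self_eq_norm_sq, inner_momentDefectVector, momentDefect, fourthMoment]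
  congr 3
  exact Finset.sum_congr rfl fun w _ => by ring

/- The operator `A = momentDefectVector M y z` is symmetric and `⟪A w, w⟫ = 0` for all points `w`.
Since `A` is a combination of `1`, `y ⊗ z`, `z ⊗ y` and the `w ⊗ w`, this makes the trace of `A²`
vanish. -/
theorem momentDefect_eq_zero (hd : 2 ≤ d) (hM : IsMUB M) (hf : (f : ℝ) = d / 2 + 1)
    (y : mubPoints M) (u v z : EuclideanSpace ℝ (Fin d)) : momentDefect M u v y z = 0 := by
  let b := EuclideanSpace.basisFun (Fin d) ℝ
  let A := momentDefectVector M y.1 z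
  have hsymm (p q) : ⟪A p, q⟫_ℝ = ⟪A q, p⟫_ℝ := by
    rw [inner_momentDefectVector, inner_momentDefectVector, momentDefect_swap]
  have hparseval (p q) : ∑ i, ⟪b i, p⟫_ℝ * ⟪A (b i), q⟫_ℝ = ⟪A p, q⟫_ℝ := by
    simp only [hsymm _ q, ← b.sum_inner_mul_inner (A q) p, mul_comm]
  have htrace : ∑ i, ⟪b i, A (b i)⟫_ℝ = 0 := by
    simp only [← sum_momentDefect_basis hd hM hf b y.1 z, ← inner_momentDefectVector, A,
      real_inner_comm]
  have hpoint (w : mubPoints M) : ⟪A w.1, w.1⟫_ℝ = 0 := by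
    rw [inner_momentDefectVector, momentDefect_self_self hd hM hf]
  have hyz : ⟪A y.1, z⟫_ℝ = 0 := by
    rw [inner_momentDefectVector, momentDefect_rotate, momentDefect_self_self hd hM hf]
  have hsq : ∑ i, ‖A (b i)‖ ^ 2 = 0 := by
    have hexpand (i) : ‖A (b i)‖ ^ 2 =
        ∑ w : mubPoints M,
            ⟪y.1, w.1⟫_ℝ * ⟪z, w.1⟫_ℝ * (⟪b i, w.1⟫_ℝ * ⟪A (b i), w.1⟫_ℝ) -
          ⟪y.1, z⟫_ℝ * ⟪b i, A (b i)⟫_ℝ - ⟪b i, y.1⟫_ℝ * ⟪A (b i), z⟫_ℝ -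
          ⟪b i, z⟫_ℝ * ⟪A (b i), y.1⟫_ℝ := norm_sq_momentDefectVector y.1 z (b i)
    simp only [hexpand, Finset.sum_sub_distrib]
    rw [Finset.sum_comm]
    simp only [← Finset.mul_sum, hparseval, hpoint, htrace, hyz, hsymm z, mul_zero,
      Finset.sum_const_zero, sub_zero]
  have hbasis (i) : A (b i) = 0 := by
    have hi := (Finset.sum_eq_zero_iff_of_nonneg fun i _ => sq_nonneg ‖A (b i)‖).mp hsq i
      (Finset.mem_univ i)
    rwa [sq_eq_zero_iff, norm_eq_zero] at hi
  rw [← inner_momentDefectVector, ← hparseval]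
  simp only [hbasis, inner_zero_left, mul_zero, Finset.sum_const_zero]

end FourthMoment

/-! ### Angle sums and quadruple regularity -/

section AngleSums

variable {d f : ℕ} {M : Fin f → OrthonormalBasis (Fin d) ℝ (EuclideanSpace ℝ (Fin d))}

/-- The sum of `h₁⟪x₁, w⟫ h₂⟪x₂, w⟫ h₃⟪x₃, w⟫ h₄⟪x₄, w⟫` over the points `w` of `M ∪ (-M)`. The
numbers in the definition of quadruple regularity are the case of indicator functions `h`. -/
noncomputable def angleSum
    (M : Fin f → OrthonormalBasis (Fin d) ℝ (EuclideanSpace ℝ (Fin d))) (h : Fin 4 → ℝ → ℝ)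
    (x : Fin 4 → mubPoints M) : ℝ :=
  ∑ w : mubPoints M, ∏ k, h k ⟪(x k).1, w.1⟫_ℝ

/-- A function of four points depends only on their Gram matrix. -/
def IsGramInvariant (F : (Fin 4 → mubPoints M) → ℝ) : Prop :=
  ∀ x x' : Fin 4 → mubPoints M,
    (∀ k l, ⟪(x k).1, (x l).1⟫_ℝ = ⟪(x' k).1, (x' l).1⟫_ℝ) → F x = F x'

theorem isGramInvariant_angleSum_of_span {ι : Type*} [Fintype ι] (g : ι → ℝ → ℝ)
    (hspan : ∀ h : ℝ → ℝ, ∃ c : ι → ℝ, ∀ x y : mubPoints M,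
      h ⟪x.1, y.1⟫_ℝ = ∑ j, c j * g j ⟪x.1, y.1⟫_ℝ)
    (hg : ∀ J : Fin 4 → ι, IsGramInvariant (angleSum M fun k => g (J k)))
    (h : Fin 4 → ℝ → ℝ) : IsGramInvariant (angleSum M h) := by
  choose c hc using hspan
  have hexpand (x : Fin 4 → mubPoints M) : angleSum M h x =
      ∑ J : Fin 4 → ι, (∏ k, c (h k) (J k)) * angleSum M (fun k => g (J k)) x := by
    have hprod (w : mubPoints M) : ∏ k, h k ⟪(x k).1, w.1⟫_ℝ =
        ∑ J : Fin 4 → ι, (∏ k, c (h k) (J k)) * ∏ k, g (J k) ⟪(x k).1, w.1⟫_ℝ := by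
      rw [Finset.prod_congr rfl fun k _ => hc (h k) (x k) w, Fintype.prod_sum]
      simp only [Finset.prod_mul_distrib]
    simp only [angleSum, hprod, Finset.mul_sum]
    exact Finset.sum_comm
  intro x x' hx
  rw [hexpand, hexpand]
  exact Finset.sum_congr rfl fun J _ => by rw [hg J x x' hx]

theorem ncard_mubRel_eq_angleSum (i : Fin 4 → Fin 5) (x : Fin 4 → mubPoints M) :
    ({w | ∀ k, mubRel M (i k) (x k) w}.ncard : ℝ) =
      angleSum M (fun k t => if t = mubAngle d (i k) then 1 else 0) x := by
  classical
  simp only [angleSum, Finset.prod_boole, Finset.mem_univ, true_imp_iff, Finset.sum_boole,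
    Set.ncard_eq_toFinset_card', Set.toFinset_ofPred, mubRel]

theorem isQuadruplyRegular_mubRel_iff_isGramInvariant (hd : 2 ≤ d) (hM : IsMUB M) :
    IsQuadruplyRegular (mubRel M) ↔ ∀ h, IsGramInvariant (angleSum M h) := by
  classical
  constructor
  · refine fun hquad => isGramInvariant_angleSum_of_span
      (fun (j : Fin 5) t => if t = mubAngle d j then 1 else 0) (fun h => ?_) fun i x x' hx => ?_
    · refine ⟨fun j => h (mubAngle d j), fun x y => ?_⟩
      obtain ⟨k, hk⟩ := exists_inner_eq_mubAngle hM x y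
      simp [hk, (mubAngle_injective hd).eq_iff]
    · choose j hj using fun k l => exists_inner_eq_mubAngle hM (x k) (x l)
      obtain ⟨c, hc⟩ := hquad i j
      rw [← ncard_mubRel_eq_angleSum, ← ncard_mubRel_eq_angleSum, hc x fun k l _ => hj k l,
        hc x' fun k l _ => (hx k l).symm.trans (hj k l)]
  · intro hinv i j
    by_cases hex : ∃ x : Fin 4 → mubPoints M, ∀ k l, k < l → mubRel M (j k l) (x k) (x l)
    · obtain ⟨x, hx⟩ := hex
      refine ⟨{w | ∀ k, mubRel M (i k) (x k) w}.ncard, fun x' hx' => ?_⟩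
      rw [← Nat.cast_inj (R := ℝ), ncard_mubRel_eq_angleSum, ncard_mubRel_eq_angleSum]
      refine hinv _ _ _ fun k l => ?_
      rcases lt_trichotomy k l with hkl | rfl | hkl
      · exact (hx' k l hkl).trans (hx k l hkl).symm
      · rw [mubPoints_inner_self, mubPoints_inner_self]
      · rw [real_inner_comm, real_inner_comm (x l).1]
        exact (hx' l k hkl).trans (hx l k hkl).symm
    · exact ⟨0, fun x hx => absurd ⟨x, hx⟩ hex⟩

theorem angleSum_comp_neg (h : Fin 4 → ℝ → ℝ) :
    angleSum M (fun k t => h k (-t)) = angleSum M h := by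
  funext x
  refine Fintype.sum_equiv (Equiv.neg _) _ _ fun w => ?_
  simp only [Equiv.neg_apply, mubPoints_coe_neg, inner_neg_right]

theorem angleSum_id (x : Fin 4 → mubPoints M) : angleSum M (fun _ => id) x =
    fourthMoment M (x 0) (x 1) (x 2) (x 3) := by
  simp only [angleSum, fourthMoment, Fin.prod_univ_four, id]

end AngleSums

section Necessity

variable {d f : ℕ} {M : Fin f → OrthonormalBasis (Fin d) ℝ (EuclideanSpace ℝ (Fin d))}

theorem fourthMoment_eq_zero_of_inner_eq_zero
    (hinv : IsGramInvariant (angleSum M fun _ => id)) {x y z u : mubPoints M}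
    (hy : ⟪x.1, y.1⟫_ℝ = 0) (hz : ⟪x.1, z.1⟫_ℝ = 0) (hu : ⟪x.1, u.1⟫_ℝ = 0) :
    fourthMoment M x y z u = 0 := by
  have hneg : fourthMoment M x y z u = fourthMoment M (-x.1) y z u := by
    have hgram := hinv ![x, y, z, u] ![-x, y, z, u] fun k l => by
      fin_cases k <;> fin_cases l <;>
        simp [hy, hz, hu, real_inner_comm x.1]
    rwa [angleSum_id, angleSum_id] at hgram
  have hodd : fourthMoment M (-x.1) y z u = -fourthMoment M x y z u := by
    simp only [fourthMoment, inner_neg_left, neg_mul, Finset.sum_neg_distrib]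
  linarith

theorem fourthMoment_basis_eq_zero (hinv : IsGramInvariant (angleSum M fun _ => id)) (a : Fin f)
    {p q k : Fin d} (hpq : p ≠ q) (hpk : p ≠ k) (hqk : q ≠ k) (u : EuclideanSpace ℝ (Fin d)) :
    fourthMoment M u (M a p) (M a q) (M a k) = 0 := by
  have hzero {i j l m : Fin d} (hj : i ≠ j) (hl : i ≠ l) (hm : i ≠ m) :
      fourthMoment M (M a i) (M a j) (M a l) (M a m) = 0 :=
    fourthMoment_eq_zero_of_inner_eq_zero hinv (x := basisPoint M a i) (y := basisPoint M a j)
      (z := basisPoint M a l) (u := basisPoint M a m) ((M a).orthonormal.2 hj)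
      ((M a).orthonormal.2 hl) ((M a).orthonormal.2 hm)
  rw [fourthMoment_eq_sum (M a)]
  refine Finset.sum_eq_zero fun l _ => mul_eq_zero_of_right _ ?_
  by_cases hl : l = p
  · rw [hl, fourthMoment_rotate, fourthMoment_swap]
    exact hzero hpq.symm hqk hpq.symm
  · rw [fourthMoment_swap]
    exact hzero (Ne.symm hl) hpq hpk

theorem fourthMoment_basis_self_self (hd : 2 ≤ d) (hM : IsMUB M) (a : Fin f) {i j : Fin d}
    (hij : i ≠ j) (u : EuclideanSpace ℝ (Fin d)) :
    fourthMoment M (M a i) (M a i) u (M a j) = 2 * (f - 1) / d * ⟪u, M a j⟫_ℝ := by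
  rw [← coe_basisPoint a i, fourthMoment_self_self hd hM, coe_basisPoint,
    (M a).orthonormal.2 hij, mul_zero, zero_add]

/- For a point `w` of another basis, `fourthMoment M w w eₚ e_q` is known; expanding the first `w`
in the basis `e` leaves only the terms of `eₚ` and `e_q`. -/
theorem card_bases_of_isGramInvariant (hd : 2 ≤ d) (hf : 2 ≤ f) (hM : IsMUB M)
    (hinv : IsGramInvariant (angleSum M fun _ => id)) : (f : ℝ) = d / 2 + 1 := by
  have hd0 : (d : ℝ) ≠ 0 := by exact_mod_cast (by lia : d ≠ 0)
  have := Fin.nontrivial_iff_two_le.mpr hd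
  have := Fin.nontrivial_iff_two_le.mpr hf
  obtain ⟨p, q, hpq⟩ := exists_pair_ne (Fin d)
  obtain ⟨a, b, hab⟩ := exists_pair_ne (Fin f)
  let e := M a
  let w := basisPoint M b p
  have hw (i : Fin d) : ⟪w.1, e i⟫_ℝ ≠ 0 := fun h0 => by
    have hsq := hM.inner_sq hab.symm p i
    rw [show ⟪M b p, M a i⟫_ℝ = 0 from h0] at hsq
    exact one_div_ne_zero hd0 (by simpa using hsq.symm)
  have hexpand : fourthMoment M w w (e p) (e q) =
      ⟪w.1, e p⟫_ℝ * (2 * (f - 1) / d * ⟪w.1, e q⟫_ℝ) +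
        ⟪w.1, e q⟫_ℝ * (2 * (f - 1) / d * ⟪w.1, e p⟫_ℝ) := by
    have hp : fourthMoment M (e p) w (e p) (e q) = 2 * (f - 1) / d * ⟪w.1, e q⟫_ℝ := by
      rw [← fourthMoment_basis_self_self hd hM a hpq]
      exact Finset.sum_congr rfl fun _ _ => by ring
    have hq : fourthMoment M (e q) w (e p) (e q) = 2 * (f - 1) / d * ⟪w.1, e p⟫_ℝ := by
      rw [← fourthMoment_basis_self_self hd hM a hpq.symm]
      exact Finset.sum_congr rfl fun _ _ => by ring
    rw [fourthMoment_eq_sum e, Finset.sum_eq_add p q hpq _ (by simp) (by simp), hp, hq]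
    intro k _ hk
    rw [fourthMoment_swap, fourthMoment_basis_eq_zero hinv a hk.1 hk.2 hpq, mul_zero]
  rw [fourthMoment_self_self hd hM, e.orthonormal.2 hpq, mul_zero, add_zero] at hexpand
  have hf1 : (2 : ℝ) * (f - 1) / d = 1 := by
    refine mul_right_cancel₀ (mul_ne_zero (hw p) (hw q)) ?_
    linarith
  rw [div_eq_one_iff_eq hd0] at hf1
  linarith

end Necessity

section Sufficiency

variable {d f : ℕ} {M : Fin f → OrthonormalBasis (Fin d) ℝ (EuclideanSpace ℝ (Fin d))}

/-- A finite set of points of `M ∪ (-M)` which is closed under the antipodal map and is a tight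
frame of `ℝ^d` with frame constant `c`. -/
structure IsAntipodalTightFrame (W : Finset (mubPoints M)) (c : ℝ) : Prop where
  neg_mem : ∀ w ∈ W, -w ∈ W
  sum_inner_mul_inner : ∀ u v : EuclideanSpace ℝ (Fin d),
    ∑ w ∈ W, ⟪u, w.1⟫_ℝ * ⟪v, w.1⟫_ℝ = c * ⟪u, v⟫_ℝ

namespace IsAntipodalTightFrame

variable {W W' : Finset (mubPoints M)} {c : ℝ}

theorem card_eq (hW : IsAntipodalTightFrame W c) : (W.card : ℝ) = c * d := by
  let b := EuclideanSpace.basisFun (Fin d) ℝ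
  have hnorm (w : mubPoints M) : ∑ i, ⟪b i, w.1⟫_ℝ * ⟪b i, w.1⟫_ℝ = 1 := by
    simp only [← sq, b.sum_sq_inner_right, mubPoints_norm, one_pow]
  calc (W.card : ℝ) = ∑ w ∈ W, ∑ i, ⟪b i, w.1⟫_ℝ * ⟪b i, w.1⟫_ℝ := by simp [hnorm]
    _ = ∑ _i : Fin d, c := by
      rw [Finset.sum_comm]
      refine Finset.sum_congr rfl fun i _ => ?_
      rw [hW.sum_inner_mul_inner, real_inner_self_eq_norm_sq, b.norm_eq_one, one_pow, mul_one]
    _ = c * d := by simp [mul_comm]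

theorem sum_prod_inner_eq_zero (hW : IsAntipodalTightFrame W c) (x : Fin 4 → mubPoints M)
    {S : Finset (Fin 4)} (hS : Odd S.card) : ∑ w ∈ W, ∏ k ∈ S, ⟪(x k).1, w.1⟫_ℝ = 0 := by
  have hodd : ∑ w ∈ W, ∏ k ∈ S, ⟪(x k).1, w.1⟫_ℝ = -∑ w ∈ W, ∏ k ∈ S, ⟪(x k).1, w.1⟫_ℝ := by
    rw [← Finset.sum_neg_distrib]
    refine Finset.sum_nbij' (-·) (-·) hW.neg_mem hW.neg_mem (fun w _ => neg_neg w)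
      (fun w _ => neg_neg w) fun w _ => ?_
    simp only [mubPoints_coe_neg, inner_neg_right, Finset.prod_neg, hS.neg_one_pow, neg_mul,
      one_mul, neg_neg]
  linarith

theorem sum_prod_inner_eq (hW : IsAntipodalTightFrame W c) (hW' : IsAntipodalTightFrame W' c)
    {x x' : Fin 4 → mubPoints M}
    (hx : ∀ k l, ⟪(x k).1, (x l).1⟫_ℝ = ⟪(x' k).1, (x' l).1⟫_ℝ) {S : Finset (Fin 4)}
    (hS : S ≠ Finset.univ) :
    ∑ w ∈ W, ∏ k ∈ S, ⟪(x k).1, w.1⟫_ℝ = ∑ w ∈ W', ∏ k ∈ S, ⟪(x' k).1, w.1⟫_ℝ := by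
  have hcard : S.card < 4 := (Finset.card_lt_iff_ne_univ S).mpr hS
  rcases Nat.even_or_odd S.card with heven | hodd
  · obtain h0 | h2 : S.card = 0 ∨ S.card = 2 := by grind
    · simp only [Finset.card_eq_zero.mp h0, Finset.prod_empty, Finset.sum_const, nsmul_eq_mul,
        hW.card_eq, hW'.card_eq]
    · obtain ⟨k, l, hkl, rfl⟩ := Finset.card_eq_two.mp h2
      simp only [Finset.prod_pair hkl, hW.sum_inner_mul_inner, hW'.sum_inner_mul_inner, hx]
  · rw [hW.sum_prod_inner_eq_zero x hodd, hW'.sum_prod_inner_eq_zero x' hodd]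

end IsAntipodalTightFrame

theorem isAntipodalTightFrame_univ (hd : 2 ≤ d) (hM : IsMUB M) :
    IsAntipodalTightFrame (Finset.univ : Finset (mubPoints M)) (2 * f) :=
  ⟨fun _ _ => Finset.mem_univ _, sum_inner_mul_inner_mubPoints hd hM⟩

theorem isAntipodalTightFrame_basisIndex (hd : 2 ≤ d) (hM : IsMUB M) (a : Fin f) :
    IsAntipodalTightFrame ({w | basisIndex w = a} : Finset (mubPoints M)) 2 :=
  ⟨fun w => by simp [hd, hM], sum_basisIndex_eq_inner_mul_inner hd hM a⟩

theorem isAntipodalTightFrame_empty : IsAntipodalTightFrame (∅ : Finset (mubPoints M)) 0 :=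
  ⟨by simp, by simp⟩

/-- The points of `M ∪ (-M)` which lie in the same basis, up to sign, as each `x k` with
`k ∈ C`. -/
noncomputable def commonClass (x : Fin 4 → mubPoints M) (C : Finset (Fin 4)) :
    Finset (mubPoints M) :=
  {w | ∀ k ∈ C, basisIndex (x k) = basisIndex w}

theorem mem_commonClass {x : Fin 4 → mubPoints M} {C : Finset (Fin 4)} {w : mubPoints M} :
    w ∈ commonClass x C ↔ ∀ k ∈ C, basisIndex (x k) = basisIndex w := by
  rw [commonClass, Finset.mem_filter_univ]

theorem exists_isAntipodalTightFrame_commonClass (hd : 2 ≤ d) (hM : IsMUB M)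
    {x x' : Fin 4 → mubPoints M}
    (hx : ∀ k l, ⟪(x k).1, (x l).1⟫_ℝ = ⟪(x' k).1, (x' l).1⟫_ℝ) (C : Finset (Fin 4)) :
    ∃ c, IsAntipodalTightFrame (commonClass x C) c ∧
      IsAntipodalTightFrame (commonClass x' C) c := by
  obtain rfl | ⟨k₀, hk₀⟩ := C.eq_empty_or_nonempty
  · have huniv (y : Fin 4 → mubPoints M) : commonClass y ∅ = Finset.univ := by simp [commonClass]
    exact ⟨2 * f, by simp only [huniv, isAntipodalTightFrame_univ hd hM, and_self]⟩
  have hiff (k l) : basisIndex (x k) = basisIndex (x l) ↔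
      basisIndex (x' k) = basisIndex (x' l) := by
    rw [basisIndex_eq_iff hd hM, basisIndex_eq_iff hd hM, hx]
  by_cases hC : ∀ k ∈ C, basisIndex (x k) = basisIndex (x k₀)
  · have hclass (y : Fin 4 → mubPoints M) (hy : ∀ k ∈ C, basisIndex (y k) = basisIndex (y k₀)) :
        commonClass y C = ({w | basisIndex w = basisIndex (y k₀)} : Finset (mubPoints M)) := by
      ext w
      rw [mem_commonClass, Finset.mem_filter_univ]
      exact ⟨fun h => (h k₀ hk₀).symm, fun h k hk => (hy k hk).trans h.symm⟩
    rw [hclass x hC, hclass x' fun k hk => (hiff k k₀).mp (hC k hk)]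
    exact ⟨2, isAntipodalTightFrame_basisIndex hd hM _, isAntipodalTightFrame_basisIndex hd hM _⟩
  · have hempty (y : Fin 4 → mubPoints M)
        (hy : ¬∀ k ∈ C, basisIndex (y k) = basisIndex (y k₀)) : commonClass y C = ∅ :=
      Finset.eq_empty_of_forall_notMem fun w hw => hy fun k hk =>
        (mem_commonClass.mp hw k hk).trans (mem_commonClass.mp hw k₀ hk₀).symm
    rw [hempty x hC, hempty x' fun h => hC fun k hk => (hiff k k₀).mpr (h k hk)]
    exact ⟨0, isAntipodalTightFrame_empty, isAntipodalTightFrame_empty⟩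

theorem isGramInvariant_sum_prod_inner (hd : 2 ≤ d) (hM : IsMUB M) (hf : (f : ℝ) = d / 2 + 1)
    {S C : Finset (Fin 4)} (hSC : Disjoint S C) :
    IsGramInvariant fun x : Fin 4 → mubPoints M =>
      ∑ w ∈ commonClass x C, ∏ k ∈ S, ⟪(x k).1, w.1⟫_ℝ := by
  intro x x' hx
  by_cases hS : S = Finset.univ
  · have hC : C = ∅ := by
      rw [hS] at hSC
      exact top_disjoint.mp hSC
    have hmoment (y : Fin 4 → mubPoints M) :
        ∑ w ∈ commonClass y C, ∏ k ∈ S, ⟪(y k).1, w.1⟫_ℝ =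
          ⟪(y 2).1, (y 3).1⟫_ℝ * ⟪(y 0).1, (y 1).1⟫_ℝ +
          ⟪(y 0).1, (y 2).1⟫_ℝ * ⟪(y 1).1, (y 3).1⟫_ℝ +
          ⟪(y 0).1, (y 3).1⟫_ℝ * ⟪(y 1).1, (y 2).1⟫_ℝ := by
      have hdefect := momentDefect_eq_zero hd hM hf (y 2) (y 0) (y 1) (y 3)
      have hsum : ∑ w ∈ commonClass y C, ∏ k ∈ S, ⟪(y k).1, w.1⟫_ℝ =
          fourthMoment M (y 0) (y 1) (y 2) (y 3) := by
        simp [commonClass, hC, hS, fourthMoment, Fin.prod_univ_four]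
      rw [hsum]
      rw [momentDefect] at hdefect
      linarith
    simp only [hmoment, hx]
  · obtain ⟨c, hc, hc'⟩ := exists_isAntipodalTightFrame_commonClass hd hM hx C
    exact hc.sum_prod_inner_eq hc' hx hS

theorem isGramInvariant_angleSum_of_support_one {h : Fin 4 → ℝ → ℝ} {k₀ : Fin 4}
    (hk₀ : ∀ t, t ≠ 1 → h k₀ t = 0) : IsGramInvariant (angleSum M h) := by
  have hlocal (y : Fin 4 → mubPoints M) :
      angleSum M h y = ∏ k, h k ⟪(y k).1, (y k₀).1⟫_ℝ :=
    Fintype.sum_eq_single (y k₀) fun w hw => Finset.prod_eq_zero (Finset.mem_univ k₀) <|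
      hk₀ _ fun h1 => hw (mubPoints_inner_eq_one_iff.mp h1).symm
  intro x x' hx
  simp only [hlocal, hx]

/-- Functions of the angle whose linear span contains every function of the angle. -/
noncomputable def angleBasis : Fin 5 → ℝ → ℝ :=
  ![fun _ => 1, id, fun t => if t = 0 ∨ t = 1 ∨ t = -1 then 1 else 0,
    fun t => if t = 1 then 1 else 0, fun t => if t = -1 then 1 else 0]

theorem exists_angleBasis_coeff (hd : 2 ≤ d) (hM : IsMUB M) (h : ℝ → ℝ) :
    ∃ c : Fin 5 → ℝ, ∀ x y : mubPoints M,
      h ⟪x.1, y.1⟫_ℝ = ∑ j, c j * angleBasis j ⟪x.1, y.1⟫_ℝ := by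
  have hs0 := inv_sqrt_pos hd
  have hs1 := inv_sqrt_lt_one hd
  set s := 1 / √(d : ℝ) with hs
  let c₀ := (h s + h (-s)) / 2
  let c₁ := (h s - h (-s)) / (2 * s)
  let c₂ := h 0 - c₀
  refine ⟨![c₀, c₁, c₂, h 1 - c₀ - c₁ - c₂, h (-1) - c₀ + c₁ - c₂], fun x y => ?_⟩
  obtain ⟨k, hk⟩ := exists_inner_eq_mubAngle hM x y
  have hne0 : s ≠ 0 := hs0.ne'
  have hne1 : s ≠ 1 := hs1.ne
  have hneg1 : -s ≠ 1 := by linarith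
  have hs_ne_neg : s ≠ -1 := by linarith
  have hchar : (-1 : ℝ) ≠ 1 := by norm_num
  rw [hk]
  fin_cases k <;>
    simp [Fin.sum_univ_five, angleBasis, mubAngle, ← hs, hne0, hne1, hneg1, hs_ne_neg, hchar,
      hchar.symm, neg_eq_iff_eq_neg, c₂, c₁, c₀] <;> field_simp <;> ring

theorem angleBasis_apply_inner (hd : 2 ≤ d) (hM : IsMUB M) {j : Fin 5} (h3 : j ≠ 3) (h4 : j ≠ 4)
    (x w : mubPoints M) : angleBasis j ⟪x.1, w.1⟫_ℝ =
      (if j = 1 then ⟪x.1, w.1⟫_ℝ else 1) *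
        if j = 2 → basisIndex x = basisIndex w then 1 else 0 := by
  obtain rfl | rfl | rfl : j = 0 ∨ j = 1 ∨ j = 2 := by lia
  all_goals simp [angleBasis, basisIndex_eq_iff hd hM]

theorem angleSum_angleBasis_eq_sum_commonClass (hd : 2 ≤ d) (hM : IsMUB M) {J : Fin 4 → Fin 5}
    (h3 : ∀ k, J k ≠ 3) (h4 : ∀ k, J k ≠ 4) (x : Fin 4 → mubPoints M) :
    angleSum M (fun k => angleBasis (J k)) x =
      ∑ w ∈ commonClass x {k | J k = 2}, ∏ k with J k = 1, ⟪(x k).1, w.1⟫_ℝ := by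
  simp only [angleSum, angleBasis_apply_inner hd hM (h3 _) (h4 _), Finset.prod_mul_distrib,
    Finset.prod_boole, Finset.mem_univ, true_imp_iff]
  simp only [commonClass, Finset.sum_filter, Finset.prod_filter, mul_boole, Finset.mem_filter_univ]

theorem isGramInvariant_angleSum (hd : 2 ≤ d) (hM : IsMUB M) (hf : (f : ℝ) = d / 2 + 1)
    (h : Fin 4 → ℝ → ℝ) : IsGramInvariant (angleSum M h) := by
  refine isGramInvariant_angleSum_of_span angleBasis (exists_angleBasis_coeff hd hM)
    (fun J => ?_) h
  by_cases h3 : ∃ k, J k = 3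
  · obtain ⟨k₀, hk₀⟩ := h3
    refine isGramInvariant_angleSum_of_support_one (k₀ := k₀) fun t ht => ?_
    rw [hk₀]
    exact if_neg ht
  by_cases h4 : ∃ k, J k = 4
  · obtain ⟨k₀, hk₀⟩ := h4
    rw [← angleSum_comp_neg]
    refine isGramInvariant_angleSum_of_support_one (k₀ := k₀) fun t ht => ?_
    rw [hk₀]
    exact if_neg fun h1 => ht (neg_injective h1)
  push Not at h3 h4
  rw [funext (angleSum_angleBasis_eq_sum_commonClass hd hM h3 h4)]
  refine isGramInvariant_sum_prod_inner hd hM hf (Finset.disjoint_filter.mpr fun k _ h1 h2 => ?_)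
  exact absurd (h1.symm.trans h2) (by decide)

theorem isQuadruplyRegular_mubRel_iff (hd : 2 ≤ d) (hf : 2 ≤ f) (hM : IsMUB M) :
    IsQuadruplyRegular (mubRel M) ↔ (f : ℝ) = d / 2 + 1 := by
  rw [isQuadruplyRegular_mubRel_iff_isGramInvariant hd hM]
  exact ⟨fun hinv => card_bases_of_isGramInvariant hd hf hM (hinv _),
    fun h => isGramInvariant_angleSum hd hM h⟩

end Sufficiency

/-! ### Dual eigenvalues of 4-class schemes -/

section Gram

variable {X : Type*} [Fintype X] {A : Matrix X X ℝ}

theorem row_dotProduct_row_of_isIdempotentElem (hA : IsIdempotentElem A) (hsymm : A.IsSymm)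
    (x y : X) : A x ⬝ᵥ A y = A x y := by
  conv_rhs => rw [← hA.eq, Matrix.mul_apply]
  simp only [dotProduct, hsymm.apply y]

theorem row_eq_row_of_isIdempotentElem (hA : IsIdempotentElem A) (hsymm : A.IsSymm) {x y : X}
    (hx : A x x = A x y) (hy : A y y = A x y) : A x = A y := by
  rw [← sub_eq_zero, ← dotProduct_self_eq_zero]
  simp only [sub_dotProduct, dotProduct_sub, row_dotProduct_row_of_isIdempotentElem hA hsymm,
    hsymm.apply x y, hx, hy, sub_self]

theorem exists_inner_eq_of_isIdempotentElem {F : Type*} [NormedAddCommGroup F]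
    [InnerProductSpace ℝ F] [FiniteDimensional ℝ F] (hA : IsIdempotentElem A) (hsymm : A.IsSymm)
    (hrank : A.rank = Module.finrank ℝ F) : ∃ ψ : X → F, ∀ x y, ⟪ψ x, ψ y⟫_ℝ = A x y := by
  let e := (WithLp.linearEquiv 2 ℝ (X → ℝ)).symm
  let V : Submodule ℝ (EuclideanSpace ℝ X) :=
    (Submodule.span ℝ (Set.range A.row)).map (e : (X → ℝ) →ₗ[ℝ] EuclideanSpace ℝ X)
  have hV : Module.finrank ℝ V = Module.finrank ℝ F := by
    rw [← hrank, Matrix.rank_eq_finrank_span_row]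
    exact LinearEquiv.finrank_map_eq e _
  have hmem (x : X) : e (A.row x) ∈ V :=
    Submodule.mem_map_of_mem (Submodule.subset_span ⟨x, rfl⟩)
  let g : V ≃ₗᵢ[ℝ] F :=
    (stdOrthonormalBasis ℝ V).equiv (stdOrthonormalBasis ℝ F) (finCongr hV)
  refine ⟨fun x => g ⟨e (A.row x), hmem x⟩, fun x y => ?_⟩
  rw [LinearIsometryEquiv.inner_map_map, Submodule.coe_inner,
    ← row_dotProduct_row_of_isIdempotentElem hA hsymm, dotProduct_comm]
  rfl

end Gram

section OrthogonalFrame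

variable {F : Type*} [NormedAddCommGroup F] [InnerProductSpace ℝ F]

theorem exists_pairwise_orthogonal_of_inner_eq_zero_or (V : Finset F)
    (h : ∀ v ∈ V, ∀ w ∈ V, ⟪v, w⟫_ℝ = 0 ∨ v = w ∨ v = -w) :
    ∃ T ⊆ V, (T : Set F).Pairwise (fun v w => ⟪v, w⟫_ℝ = 0) ∧
      ∀ v ∈ V, ∃ t ∈ T, v = t ∨ v = -t := by
  classical
  induction V using Finset.induction_on with
  | empty => exact ⟨∅, by simp⟩
  | insert a V _ ih =>
    have hV := Finset.subset_insert a V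
    have ha := Finset.mem_insert_self a V
    obtain ⟨T, hTV, hT, hcover⟩ := ih fun v hv w hw => h v (hV hv) w (hV hw)
    by_cases hcov : ∃ t ∈ T, a = t ∨ a = -t
    · exact ⟨T, hTV.trans hV, hT, Finset.forall_mem_insert .. |>.mpr ⟨hcov, hcover⟩⟩
    have horth (t : F) (ht : t ∈ T) : ⟪a, t⟫_ℝ = 0 :=
      (h a ha t (hV (hTV ht))).resolve_right fun hat => hcov ⟨t, ht, hat⟩
    refine ⟨insert a T, Finset.insert_subset_insert a hTV, ?_,
      Finset.forall_mem_insert .. |>.mpr ⟨⟨a, by simp⟩, fun v hv => ?_⟩⟩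
    · rw [Finset.coe_insert]
      exact hT.insert fun t ht _ => ⟨horth t ht, by rw [real_inner_comm, horth t ht]⟩
    · obtain ⟨t, ht, hvt⟩ := hcover v hv
      exact ⟨t, Finset.mem_insert_of_mem ht, hvt⟩

theorem exists_orthonormalBasis_of_two_mul_finrank_le_card [FiniteDimensional ℝ F] {ι : Type*}
    [Fintype ι] (hι : Fintype.card ι = Module.finrank ℝ F) (V : Finset F)
    (hcard : 2 * Module.finrank ℝ F ≤ V.card) (hunit : ∀ v ∈ V, ‖v‖ = 1)
    (horth : ∀ v ∈ V, ∀ w ∈ V, ⟪v, w⟫_ℝ = 0 ∨ v = w ∨ v = -w) :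
    ∃ b : OrthonormalBasis ι ℝ F, (∀ i, b i ∈ V) ∧ ∀ v ∈ V, ∃ i, v = b i ∨ v = -b i := by
  classical
  obtain ⟨T, hTV, hT, hcover⟩ := exists_pairwise_orthogonal_of_inner_eq_zero_or V horth
  have hle : V.card ≤ T.card + T.card := by
    refine (Finset.card_le_card (t := T ∪ T.image Neg.neg) fun v hv => ?_).trans
      ((Finset.card_union_le _ _).trans (Nat.add_le_add_left Finset.card_image_le _))
    obtain ⟨t, ht, rfl | rfl⟩ := hcover v hv <;> simp [ht]
  have hon : Orthonormal ℝ ((↑) : T → F) :=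
    ⟨fun t => hunit _ (hTV t.2), fun s t hst => hT s.2 t.2 (Subtype.coe_injective.ne hst)⟩
  have hTle := hon.linearIndependent.fintype_card_le_finrank
  rw [Fintype.card_coe] at hTle
  have hTcard : Fintype.card T = Fintype.card ι := by rw [Fintype.card_coe]; omega
  let g : ι ≃ T := Fintype.equivOfCardEq hTcard.symm
  obtain ⟨b, hb⟩ := Orthonormal.exists_orthonormalBasis_extension_of_card_eq (𝕜 := ℝ)
    (v := fun i => (g i : F)) (s := Set.univ) hι.symm
    ((hon.comp g g.injective).comp _ Subtype.val_injective)
  replace hb i : b i = g i := hb i (Set.mem_univ i)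
  refine ⟨b, fun i => hb i ▸ hTV (g i).2, fun v hv => ?_⟩
  obtain ⟨t, ht, hvt⟩ := hcover v hv
  exact ⟨g.symm ⟨t, ht⟩, by simpa only [hb, g.apply_symm_apply] using hvt⟩

end OrthogonalFrame

/-- The dual eigenvalue of `E_j` on the relation containing `(x, y)`, that is, the
corresponding entry of the `j`-th column of the second eigenmatrix of the scheme.  It is
indexed by pairs of points instead of relations, as the value of `E_j` is all that is used. -/
noncomputable def dualEigenvalue {X : Type*} [Fintype X] {n : ℕ}
    (E : Fin (n + 1) → Matrix X X ℝ) (j : Fin (n + 1)) (x y : X) : ℝ :=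
  Fintype.card X * E j x y

section DualEigenvalue

variable {X : Type*} [Fintype X] [DecidableEq X] {n : ℕ} {R : Fin (n + 1) → X → X → Prop}
  {E : Fin (n + 1) → Matrix X X ℝ}

theorem dualEigenvalue_mul (hR : IsSymmetricAssociationScheme R)
    (hE : IsPrimitiveIdempotentOrdering R E) (i j : Fin (n + 1)) (x y : X) :
    dualEigenvalue E i x y * dualEigenvalue E j x y =
      ∑ k, kreinNumber E i j k * dualEigenvalue E k x y := by
  have h : E i x y * E j x y =
      (Fintype.card X : ℝ)⁻¹ * ∑ k, kreinNumber E i j k * E k x y := by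
    simpa [Matrix.sum_apply] using congrFun₂ (hadamard_eq_sum_kreinNumber hR hE i j) x y
  rw [dualEigenvalue, dualEigenvalue, mul_mul_mul_comm, h, mul_assoc,
    mul_inv_cancel_left₀ hR.card_ne_zero, Finset.mul_sum]
  exact Finset.sum_congr rfl fun k _ => mul_left_comm ..

theorem dualEigenvalue_zero (hR : IsSymmetricAssociationScheme R)
    (hE : IsPrimitiveIdempotentOrdering R E) (x y : X) : dualEigenvalue E 0 x y = 1 := by
  rw [dualEigenvalue, hE.zero_eq, Matrix.of_apply, mul_inv_cancel₀ hR.card_ne_zero]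

theorem sum_dualEigenvalue_self (hE : IsPrimitiveIdempotentOrdering R E) (x : X) :
    ∑ j, dualEigenvalue E j x x = Fintype.card X := by
  simp only [dualEigenvalue, ← Finset.mul_sum]
  rw [← Matrix.sum_apply, hE.sum_eq_one, Matrix.one_apply_eq, mul_one]

theorem eq_of_dualEigenvalue_eq_self (hR : IsSymmetricAssociationScheme R)
    (hE : IsPrimitiveIdempotentOrdering R E) {x y : X}
    (h : ∀ j, dualEigenvalue E j x y = dualEigenvalue E j x x) : x = y :=
  (hR.rel_zero_iff x y).mp <| hE.rel_of_apply_eq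
    (fun j => (mul_left_cancel₀ hR.card_ne_zero (h j)).symm) ((hR.rel_zero_iff x x).mpr rfl)

end DualEigenvalue

theorem IsSymmetricAssociationScheme.exists_rel {X : Type*} [Fintype X] {n : ℕ}
    {R : Fin (n + 1) → X → X → Prop} (hR : IsSymmetricAssociationScheme R) (k : Fin (n + 1))
    (x : X) : ∃ y, R k x y := by
  obtain ⟨p, hp⟩ := hR.intersection_number k k 0
  obtain ⟨a, b, hab⟩ := hR.rel_nonempty k
  have hcount : {z | R k a z ∧ R k z a}.ncard = {z | R k x z ∧ R k z x}.ncard :=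
    (hp a a ((hR.rel_zero_iff a a).mpr rfl)).trans (hp x x ((hR.rel_zero_iff x x).mpr rfl)).symm
  have hpos : 0 < {z | R k a z ∧ R k z a}.ncard :=
    (Set.ncard_pos (Set.toFinite _)).mpr ⟨b, hab, hR.rel_symm k a b hab⟩
  rw [hcount, Set.ncard_pos (Set.toFinite _)] at hpos
  obtain ⟨y, hy, -⟩ := hpos
  exact ⟨y, hy⟩

/-- A 4-class scheme whose dual eigenvalues satisfy the three-term recurrences of a
`Q`-polynomial, `Q`-antipodal and `Q`-bipartite ordering with `d = rank E_1`.  The remaining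
parameter is `r = d / c_2^*`, which turns out to be the number of `Q`-antipodal classes. -/
structure DualRecurrence {X : Type*} [Fintype X] [DecidableEq X] (R : Fin 5 → X → X → Prop)
    (E : Fin 5 → Matrix X X ℝ) (d : ℕ) (r : ℝ) : Prop where
  scheme : IsSymmetricAssociationScheme R
  ordering : IsPrimitiveIdempotentOrdering R E
  rank_one : (E 1).rank = d
  rank_ne_one : d ≠ 1
  ratio_ne_zero : r ≠ 0
  ratio_ne_one : r ≠ 1
  one_mul_one : ∀ x y, dualEigenvalue E 1 x y * dualEigenvalue E 1 x y =
    d + d / r * dualEigenvalue E 2 x y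
  one_mul_two : ∀ x y, dualEigenvalue E 1 x y * dualEigenvalue E 2 x y =
    (d - 1) * dualEigenvalue E 1 x y + (d - 1) * dualEigenvalue E 3 x y
  one_mul_three : ∀ x y, dualEigenvalue E 1 x y * dualEigenvalue E 3 x y =
    (d - d / r) * dualEigenvalue E 2 x y + d * dualEigenvalue E 4 x y
  one_mul_four : ∀ x y, dualEigenvalue E 1 x y * dualEigenvalue E 4 x y = dualEigenvalue E 3 x y

theorem kreinNumber_one_eq {X : Type*} [Fintype X] [DecidableEq X] {R : Fin 5 → X → X → Prop}
    {E : Fin 5 → Matrix X X ℝ} (hR : IsSymmetricAssociationScheme R)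
    (hE : IsPrimitiveIdempotentOrdering R E) (hQ : IsQPolynomial E) (hA : IsQAntipodal E)
    (hB : IsQBipartite E) :
    Matrix.of (kreinNumber E 1) =
      !![0, 1, 0, 0, 0;
        (E 1).trace, 0, kreinNumber E 1 1 2, 0, 0;
        0, (E 1).trace - 1, 0, (E 1).trace - 1, 0;
        0, 0, (E 1).trace - kreinNumber E 1 1 2, 0, (E 1).trace;
        0, 0, 0, 1, 0] := by
  have zero_of_far (j k : Fin 5) (h : (j : ℕ) + 1 < k ∨ (k : ℕ) + 1 < j) :
      kreinNumber E 1 j k = 0 := (hQ j k).1 h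
  have diag (j : Fin 5) : kreinNumber E 1 j j = 0 := hB j
  have q01 : kreinNumber E 1 0 1 = 1 := by simp [hE.kreinNumber_zero_right hR]
  have hcol (k : Fin 5) : kreinNumber E 1 0 k + kreinNumber E 1 1 k + kreinNumber E 1 2 k +
      kreinNumber E 1 3 k + kreinNumber E 1 4 k = (E 1).trace :=
    (Fin.sum_univ_five _).symm.trans (hE.sum_kreinNumber hR 1 k)
  have q10 : kreinNumber E 1 1 0 = (E 1).trace := by
    simpa [diag, zero_of_far] using hcol 0
  have q21 : kreinNumber E 1 2 1 = (E 1).trace - 1 := by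
    have h := hcol 1
    simp only [q01, diag, zero_of_far 3 1 (by simp), zero_of_far 4 1 (by simp)] at h
    linarith
  have q32 : kreinNumber E 1 3 2 = (E 1).trace - kreinNumber E 1 1 2 := by
    have h := hcol 2
    simp only [diag, zero_of_far 0 2 (by simp), zero_of_far 4 2 (by simp)] at h
    linarith
  have q34 : kreinNumber E 1 3 4 = (E 1).trace := (hA 0 (by simp)).symm.trans q10
  have q23 : kreinNumber E 1 2 3 = (E 1).trace - 1 := (hA 1 (by simp)).symm.trans q21
  have q43 : kreinNumber E 1 4 3 = 1 := (hA 3 (by simp)).trans q01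
  ext j k
  fin_cases j <;> fin_cases k <;>
    simp [q01, q10, q21, q23, q32, q34, q43, diag, zero_of_far]

theorem dualRecurrence_of_isQPolynomial {X : Type*} [Fintype X] [DecidableEq X]
    {R : Fin 5 → X → X → Prop} {E : Fin 5 → Matrix X X ℝ}
    (hR : IsSymmetricAssociationScheme R) (hE : IsPrimitiveIdempotentOrdering R E)
    (hQ : IsQPolynomial E) (hA : IsQAntipodal E) (hB : IsQBipartite E) :
    DualRecurrence R E (E 1).rank ((E 1).rank / kreinNumber E 1 1 2) := by
  have hd : ((E 1).rank : ℝ) = (E 1).trace := rank_eq_trace_of_isIdempotentElem (hE.idem 1)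
  have hd0 : ((E 1).rank : ℝ) ≠ 0 := hd ▸ hE.trace_ne_zero 1
  have hc0 : kreinNumber E 1 1 2 ≠ 0 := (hQ 1 2).2 (by simp)
  have hq := kreinNumber_one_eq hR hE hQ hA hB
  rw [← hd] at hq
  have hmul (j : Fin 5) (x y : X) : dualEigenvalue E 1 x y * dualEigenvalue E j x y =
      (Matrix.of (kreinNumber E 1) *ᵥ fun k => dualEigenvalue E k x y) j :=
    dualEigenvalue_mul hR hE 1 j x y
  simp only [hq] at hmul
  have h21 : kreinNumber E 1 2 1 = (E 1).rank - 1 := congrFun₂ hq 2 1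
  have h32 : kreinNumber E 1 3 2 = (E 1).rank - kreinNumber E 1 1 2 := congrFun₂ hq 3 2
  refine ⟨hR, hE, rfl, fun h => (hQ 2 1).2 (by simp) ?_, div_ne_zero hd0 hc0,
    fun h => (hQ 3 2).2 (by simp) ?_, fun x y => ?_, fun x y => ?_, fun x y => ?_, fun x y => ?_⟩
  · rw [h21, h, Nat.cast_one, sub_self]
  · rw [h32, eq_of_div_eq_one h, sub_self]
  all_goals
    simp [hmul, Matrix.mulVec, dotProduct, Fin.sum_univ_five, dualEigenvalue_zero hR hE,
      div_div_cancel₀ hd0]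

namespace DualRecurrence

variable {X : Type*} [Fintype X] [DecidableEq X] {R : Fin 5 → X → X → Prop}
  {E : Fin 5 → Matrix X X ℝ} {d : ℕ} {r : ℝ}

theorem two_le (h : DualRecurrence R E d r) : 2 ≤ d := by
  have hd0 : d ≠ 0 := by
    have htrace := rank_eq_trace_of_isIdempotentElem (h.ordering.idem 1)
    rw [h.rank_one] at htrace
    exact_mod_cast htrace.trans_ne (h.ordering.trace_ne_zero 1)
  have hd1 := h.rank_ne_one
  omega

theorem cast_ne_zero (h : DualRecurrence R E d r) : (d : ℝ) ≠ 0 := by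
  have := h.two_le
  positivity

theorem dualEigenvalue_cases (h : DualRecurrence R E d r) (x y : X) :
    (dualEigenvalue E 1 x y = 0 ∧ dualEigenvalue E 4 x y = r - 1) ∨
      (dualEigenvalue E 1 x y ^ 2 = d ∧ dualEigenvalue E 4 x y = -1) ∨
      (dualEigenvalue E 1 x y ^ 2 = (d : ℝ) ^ 2 ∧ dualEigenvalue E 2 x y = (d - 1) * r ∧
        dualEigenvalue E 4 x y = r - 1) := by
  have hd0 := h.cast_ne_zero
  have hr0 := h.ratio_ne_zero
  have hd1 : (d : ℝ) - 1 ≠ 0 := sub_ne_zero.mpr (by exact_mod_cast h.rank_ne_one)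
  have h1 := h.one_mul_one x y
  have h2 := h.one_mul_two x y
  have h3 := h.one_mul_three x y
  rw [← h.one_mul_four x y] at h2 h3
  generalize dualEigenvalue E 1 x y = u, dualEigenvalue E 2 x y = v₂,
    dualEigenvalue E 4 x y = v₄ at *
  field_simp at h1 h3
  by_cases hu : u = 0
  · subst hu
    have hv₂ : v₂ = -r := mul_left_cancel₀ hd0 (by linarith)
    refine Or.inl ⟨rfl, mul_left_cancel₀ (mul_ne_zero hd0 hr0) ?_⟩
    rw [hv₂] at h3
    linear_combination -h3
  have hv₂ : v₂ = (d - 1) * (1 + v₄) := mul_left_cancel₀ hu (by linear_combination h2)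
  rw [hv₂] at h1 h3
  have hv₄ : (1 + v₄) * (v₄ - (r - 1)) = 0 :=
    mul_left_cancel₀ (mul_ne_zero hd0 hd1) (by linear_combination h3 - v₄ * h1)
  rcases mul_eq_zero.mp hv₄ with hv₄ | hv₄
  · refine Or.inr (Or.inl ⟨mul_left_cancel₀ hr0 ?_, by linarith⟩)
    rw [hv₄] at h1
    linear_combination h1
  · have hv₄' : 1 + v₄ = r := by linarith
    refine Or.inr (Or.inr ⟨mul_left_cancel₀ hr0 ?_, by rw [hv₂, hv₄'], by linarith⟩)
    rw [hv₄'] at h1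
    linear_combination h1

theorem dualEigenvalue_eq_of_one_eq (h : DualRecurrence R E d r) {x y x' y' : X}
    (hxy : dualEigenvalue E 1 x y = dualEigenvalue E 1 x' y') (j : Fin 5) :
    dualEigenvalue E j x y = dualEigenvalue E j x' y' := by
  have hd0 := h.cast_ne_zero
  have hd1 : (d : ℝ) - 1 ≠ 0 := sub_ne_zero.mpr (by exact_mod_cast h.rank_ne_one)
  have h2 : dualEigenvalue E 2 x y = dualEigenvalue E 2 x' y' :=
    mul_left_cancel₀ (div_ne_zero hd0 h.ratio_ne_zero) <| add_left_cancel (a := (d : ℝ)) <| by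
      rw [← h.one_mul_one, ← h.one_mul_one, hxy]
  have h3 : dualEigenvalue E 3 x y = dualEigenvalue E 3 x' y' :=
    mul_left_cancel₀ hd1 <| add_left_cancel (a := (d - 1) * dualEigenvalue E 1 x y) <| by
      rw [← h.one_mul_two, hxy, h2, ← h.one_mul_two]
  have h4 : dualEigenvalue E 4 x y = dualEigenvalue E 4 x' y' :=
    mul_left_cancel₀ hd0 <| add_left_cancel (a := (d - d / r) * dualEigenvalue E 2 x y) <| by
      rw [← h.one_mul_three, hxy, h2, h3, ← h.one_mul_three]
  fin_cases j
  exacts [by simp [dualEigenvalue_zero h.scheme h.ordering], hxy, h2, h3, h4]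

theorem dualEigenvalue_one_self (h : DualRecurrence R E d r) (x : X) :
    dualEigenvalue E 1 x x = d := by
  rw [dualEigenvalue, h.ordering.card_mul_diag h.scheme,
    ← rank_eq_trace_of_isIdempotentElem (h.ordering.idem 1), h.rank_one]

theorem eq_of_dualEigenvalue_one_eq (h : DualRecurrence R E d r) {x y : X}
    (hxy : dualEigenvalue E 1 x y = d) : x = y :=
  eq_of_dualEigenvalue_eq_self h.scheme h.ordering
    (h.dualEigenvalue_eq_of_one_eq (hxy.trans (h.dualEigenvalue_one_self x).symm))

theorem dualEigenvalue_two_four_self (h : DualRecurrence R E d r) (x : X) :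
    dualEigenvalue E 2 x x = (d - 1) * r ∧ dualEigenvalue E 4 x x = r - 1 := by
  have hd2 : (2 : ℝ) ≤ d := by exact_mod_cast h.two_le
  have hself := h.dualEigenvalue_one_self x
  rcases h.dualEigenvalue_cases x x with ⟨h1, -⟩ | ⟨h1, -⟩ | ⟨-, h2, h4⟩
  · linarith
  · rw [hself] at h1
    nlinarith
  · exact ⟨h2, h4⟩

theorem card_eq (h : DualRecurrence R E d r) : (Fintype.card X : ℝ) = 2 * d * r := by
  obtain ⟨x, -⟩ := h.scheme.rel_nonempty 0
  obtain ⟨h2, h4⟩ := h.dualEigenvalue_two_four_self x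
  have hsum := (Fin.sum_univ_five _).symm.trans (sum_dualEigenvalue_self h.ordering x)
  rw [dualEigenvalue_zero h.scheme h.ordering, ← h.one_mul_four, h.dualEigenvalue_one_self, h2,
    h4] at hsum
  rw [← hsum]
  ring

theorem exists_mubAngle (h : DualRecurrence R E d r) (x y : X) :
    ∃ k, dualEigenvalue E 1 x y / d = mubAngle d k := by
  have hd0 := h.cast_ne_zero
  rcases h.dualEigenvalue_cases x y with ⟨h1, -⟩ | ⟨h1, -⟩ | ⟨h1, -⟩
  · exact ⟨2, by rw [h1, zero_div]; rfl⟩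
  · have hsq : (dualEigenvalue E 1 x y / d) ^ 2 = (1 / √(d : ℝ)) ^ 2 := by
      rw [inv_sqrt_sq, div_pow, h1]
      field_simp
    rcases sq_eq_sq_iff_eq_or_eq_neg.mp hsq with hu | hu
    exacts [⟨1, hu⟩, ⟨3, hu⟩]
  · rcases sq_eq_sq_iff_eq_or_eq_neg.mp h1 with hu | hu
    · exact ⟨0, by rw [hu, div_self hd0]; rfl⟩
    · exact ⟨4, by rw [hu, neg_div, div_self hd0]; rfl⟩

theorem exists_perm_rel_iff (h : DualRecurrence R E d r) :
    ∃ σ : Equiv.Perm (Fin 5), ∀ k x y,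
      R k x y ↔ dualEigenvalue E 1 x y / d = mubAngle d (σ k) := by
  choose a b hab using h.scheme.rel_nonempty
  choose τ hτ using fun k => h.exists_mubAngle (a k) (b k)
  have hrel (k : Fin 5) (x y : X) (hk : R k x y) :
      dualEigenvalue E 1 x y / d = mubAngle d (τ k) := by
    rw [← hτ, dualEigenvalue, dualEigenvalue, apply_eq_of_mem_boseMesner h.scheme.rel_partition
      (h.ordering.mem_boseMesner 1) hk (hab k)]
  have hτinj : Function.Injective τ := by
    intro k l hkl
    have h1 : dualEigenvalue E 1 (a k) (b k) = dualEigenvalue E 1 (a l) (b l) :=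
      (div_left_inj' h.cast_ne_zero).mp (by rw [hτ, hτ, hkl])
    have hk : R k (a l) (b l) := h.ordering.rel_of_apply_eq
      (fun j => mul_left_cancel₀ h.scheme.card_ne_zero (h.dualEigenvalue_eq_of_one_eq h1 j)) (hab k)
    exact (h.scheme.rel_partition _ _).unique hk (hab l)
  refine ⟨Equiv.ofBijective τ (Finite.injective_iff_bijective.mp hτinj), fun k x y =>
    ⟨hrel k x y, fun hxy => ?_⟩⟩
  obtain ⟨l, hl, -⟩ := h.scheme.rel_partition x y
  have hlk : l = k := hτinj (mubAngle_injective h.two_le ((hrel l x y hl).symm.trans hxy))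
  exact hlk ▸ hl

end DualRecurrence

/-! ### Representation by mutually unbiased bases -/

namespace DualRecurrence

variable {X : Type*} [Fintype X] [DecidableEq X] {R : Fin 5 → X → X → Prop}
  {E : Fin 5 → Matrix X X ℝ} {d : ℕ} {r : ℝ}

theorem card_mul_zero_add_four (h : DualRecurrence R E d r) (x y : X) :
    Fintype.card X * (E 0 + E 4) x y = 1 + dualEigenvalue E 4 x y := by
  rw [Matrix.add_apply, mul_add]
  exact congrArg (· + _) (dualEigenvalue_zero h.scheme h.ordering x y)

theorem mem_qAntipodalClass_iff (h : DualRecurrence R E d r) {x y : X} :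
    y ∈ qAntipodalClass E x ↔ dualEigenvalue E 4 x y = r - 1 := by
  have hr0 := h.ratio_ne_zero
  have hmem : y ∈ qAntipodalClass E x ↔ 1 + dualEigenvalue E 4 x y ≠ 0 := by
    rw [← h.card_mul_zero_add_four, mul_ne_zero_iff_left h.scheme.card_ne_zero]
    rfl
  rw [hmem]
  rcases h.dualEigenvalue_cases x y with ⟨-, h4⟩ | ⟨-, h4⟩ | ⟨-, -, h4⟩ <;> rw [h4]
  · simpa using hr0
  · simpa [neg_eq_iff_eq_neg, eq_comm] using hr0
  · simpa using hr0

theorem isIdempotentElem_zero_add_four (h : DualRecurrence R E d r) :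
    IsIdempotentElem (E 0 + E 4) :=
  IsIdempotentElem.add (h.ordering.idem 0) (h.ordering.idem 4) <| by
    rw [h.ordering.orth 0 4 (by decide), h.ordering.orth 4 0 (by decide), add_zero]

theorem isSymm_zero_add_four (h : DualRecurrence R E d r) : (E 0 + E 4).IsSymm :=
  h.scheme.isSymm_of_mem_boseMesner
    (Submodule.add_mem _ (h.ordering.mem_boseMesner 0) (h.ordering.mem_boseMesner 4))

theorem mem_qAntipodalClass_self (h : DualRecurrence R E d r) (x : X) :
    x ∈ qAntipodalClass E x :=
  h.mem_qAntipodalClass_iff.mpr (h.dualEigenvalue_two_four_self x).2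

theorem qAntipodalClass_eq_iff (h : DualRecurrence R E d r) {x y : X} :
    qAntipodalClass E x = qAntipodalClass E y ↔ y ∈ qAntipodalClass E x := by
  refine ⟨fun hxy => hxy ▸ h.mem_qAntipodalClass_self y, fun hy => ?_⟩
  have entry_eq (z : X) : (E 0 + E 4) z z = (E 0 + E 4) x y := by
    apply mul_left_cancel₀ h.scheme.card_ne_zero
    rw [h.card_mul_zero_add_four, h.card_mul_zero_add_four, (h.dualEigenvalue_two_four_self z).2,
      h.mem_qAntipodalClass_iff.mp hy]
  have hrow := row_eq_row_of_isIdempotentElem h.isIdempotentElem_zero_add_four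
    h.isSymm_zero_add_four (entry_eq x) (entry_eq y)
  ext z
  exact not_congr (congrFun hrow z ▸ Iff.rfl)

theorem ncard_qAntipodalClass (h : DualRecurrence R E d r) (x : X) :
    (qAntipodalClass E x).ncard = 2 * d := by
  classical
  have hentry (z : X) : Fintype.card X * (E 0 + E 4) x z =
      if z ∈ qAntipodalClass E x then r else 0 := by
    split_ifs with hz
    · rw [h.card_mul_zero_add_four, h.mem_qAntipodalClass_iff.mp hz, add_sub_cancel]
    · exact mul_eq_zero_of_right _ (not_not.mp hz)
  have hself : Fintype.card X * (E 0 + E 4) x x = r := by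
    rw [hentry, if_pos (h.mem_qAntipodalClass_self x)]
  have hsum : ((qAntipodalClass E x).ncard : ℝ) * (r * r) = 2 * d * (r * r) := calc
    _ = ∑ z, (Fintype.card X * (E 0 + E 4) x z) * (Fintype.card X * (E 0 + E 4) x z) := by
      simp_rw [hentry, ite_mul_ite, mul_zero]
      rw [← Finset.sum_filter, Finset.sum_const, nsmul_eq_mul, Set.ncard_eq_toFinset_card',
        Set.filter_mem_univ_eq_toFinset]
    _ = Fintype.card X * (Fintype.card X * ((E 0 + E 4) x ⬝ᵥ (E 0 + E 4) x)) := by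
      simp only [dotProduct, Finset.mul_sum]
      exact Finset.sum_congr rfl fun z _ => by ring
    _ = Fintype.card X * r := by
      rw [row_dotProduct_row_of_isIdempotentElem h.isIdempotentElem_zero_add_four
        h.isSymm_zero_add_four, hself]
    _ = 2 * d * (r * r) := by rw [h.card_eq, mul_assoc]
  exact_mod_cast mul_right_cancel₀ (mul_ne_zero h.ratio_ne_zero h.ratio_ne_zero) hsum

theorem numQAntipodalClasses_eq (h : DualRecurrence R E d r) :
    (numQAntipodalClasses E : ℝ) = r := by
  classical
  have hnum : numQAntipodalClasses E = (Finset.univ.image (qAntipodalClass E)).card := by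
    rw [numQAntipodalClasses, ← Set.ncard_coe_finset, Finset.coe_image, Finset.coe_univ,
      Set.image_univ]
  have hcard : Fintype.card X = numQAntipodalClasses E * (2 * d) := by
    rw [hnum, ← Finset.card_univ, Finset.card_eq_sum_card_image (qAntipodalClass E) Finset.univ]
    refine Finset.sum_const_nat fun S hS => ?_
    obtain ⟨x, -, rfl⟩ := Finset.mem_image.mp hS
    rw [← h.ncard_qAntipodalClass x, ← Set.ncard_coe_finset]
    congr 1
    ext y
    simp [eq_comm (b := qAntipodalClass E x), h.qAntipodalClass_eq_iff]
  have hcard' := h.card_eq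
  rw [hcard] at hcard'
  push_cast at hcard'
  exact mul_left_cancel₀ (mul_ne_zero two_ne_zero h.cast_ne_zero) (by linarith)

theorem two_le_numQAntipodalClasses (h : DualRecurrence R E d r) :
    2 ≤ numQAntipodalClasses E := by
  have hnum := h.numQAntipodalClasses_eq
  have h0 : numQAntipodalClasses E ≠ 0 := by exact_mod_cast hnum.trans_ne h.ratio_ne_zero
  have h1 : numQAntipodalClasses E ≠ 1 := by exact_mod_cast hnum.trans_ne h.ratio_ne_one
  omega

theorem exists_qAntipodalClass_representatives (h : DualRecurrence R E d r) :
    ∃ s : Fin (numQAntipodalClasses E) → X,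
      (∀ a b, qAntipodalClass E (s a) = qAntipodalClass E (s b) → a = b) ∧
      ∀ x, ∃ a, x ∈ qAntipodalClass E (s a) := by
  let ε : Fin (numQAntipodalClasses E) ≃ Set.range (qAntipodalClass E) :=
    (Finite.equivFinOfCardEq rfl).symm
  choose s hs using fun a => (ε a).2
  refine ⟨s, fun a b hab => ε.injective (Subtype.ext (by rw [← hs, ← hs, hab])), fun x =>
    ⟨ε.symm ⟨_, x, rfl⟩, ?_⟩⟩
  rw [hs, ε.apply_symm_apply]
  exact h.mem_qAntipodalClass_self x

section Representation

variable {F : Type*} [NormedAddCommGroup F] [InnerProductSpace ℝ F]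

theorem exists_representation [FiniteDimensional ℝ F] (h : DualRecurrence R E d r)
    (hF : Module.finrank ℝ F = d) :
    ∃ ψ : X → F, ∀ x y, ⟪ψ x, ψ y⟫_ℝ = dualEigenvalue E 1 x y / d := by
  obtain ⟨ψ, hψ⟩ := exists_inner_eq_of_isIdempotentElem (F := F) (h.ordering.idem 1)
    (h.scheme.isSymm_of_mem_boseMesner (h.ordering.mem_boseMesner 1)) (h.rank_one.trans hF.symm)
  refine ⟨fun x => √((Fintype.card X : ℝ) / d) • ψ x, fun x y => ?_⟩
  rw [real_inner_smul_left, real_inner_smul_right, hψ, ← mul_assoc,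
    Real.mul_self_sqrt (by positivity), dualEigenvalue, div_mul_eq_mul_div]

variable {ψ : X → F}

theorem norm_representation (h : DualRecurrence R E d r)
    (hψ : ∀ x y, ⟪ψ x, ψ y⟫_ℝ = dualEigenvalue E 1 x y / d) (x : X) : ‖ψ x‖ = 1 := by
  rw [← sq_eq_sq₀ (norm_nonneg _) zero_le_one, ← real_inner_self_eq_norm_sq, hψ,
    h.dualEigenvalue_one_self, div_self h.cast_ne_zero, one_pow]

theorem representation_injective (h : DualRecurrence R E d r)
    (hψ : ∀ x y, ⟪ψ x, ψ y⟫_ℝ = dualEigenvalue E 1 x y / d) : Function.Injective ψ := by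
  intro x y hxy
  have hinner : ⟪ψ x, ψ y⟫_ℝ = 1 := by
    rw [hxy, real_inner_self_eq_norm_sq, h.norm_representation hψ, one_pow]
  rw [hψ, div_eq_one_iff_eq h.cast_ne_zero] at hinner
  exact h.eq_of_dualEigenvalue_one_eq hinner

theorem inner_representation_of_mem (h : DualRecurrence R E d r)
    (hψ : ∀ x y, ⟪ψ x, ψ y⟫_ℝ = dualEigenvalue E 1 x y / d) {x y : X}
    (hy : y ∈ qAntipodalClass E x) : ⟪ψ x, ψ y⟫_ℝ = 0 ∨ ψ x = ψ y ∨ ψ x = -ψ y := by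
  have hx1 := h.norm_representation hψ x
  have hy1 := h.norm_representation hψ y
  rw [h.mem_qAntipodalClass_iff] at hy
  rcases h.dualEigenvalue_cases x y with ⟨h1, -⟩ | ⟨-, h4⟩ | ⟨h1, -⟩
  · exact Or.inl (by rw [hψ, h1, zero_div])
  · exact absurd (by linarith : r = 0) h.ratio_ne_zero
  · rcases sq_eq_sq_iff_eq_or_eq_neg.mp h1 with hu | hu
    · refine Or.inr (Or.inl ((inner_eq_one_iff_of_norm_eq_one (𝕜 := ℝ) hx1 hy1).mp ?_))
      rw [hψ, hu, div_self h.cast_ne_zero]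
    · refine Or.inr (Or.inr ((inner_eq_one_iff_of_norm_eq_one (𝕜 := ℝ) hx1 ?_).mp ?_))
      · rw [norm_neg, hy1]
      · rw [inner_neg_right, hψ, hu, neg_div, div_self h.cast_ne_zero, neg_neg]

theorem inner_representation_of_notMem (h : DualRecurrence R E d r)
    (hψ : ∀ x y, ⟪ψ x, ψ y⟫_ℝ = dualEigenvalue E 1 x y / d) {x y : X}
    (hy : y ∉ qAntipodalClass E x) :
    ⟪ψ x, ψ y⟫_ℝ = 1 / √(d : ℝ) ∨ ⟪ψ x, ψ y⟫_ℝ = -(1 / √(d : ℝ)) := by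
  have hd0 := h.cast_ne_zero
  rw [h.mem_qAntipodalClass_iff] at hy
  rcases h.dualEigenvalue_cases x y with ⟨-, h4⟩ | ⟨h1, -⟩ | ⟨-, -, h4⟩
  · exact absurd h4 hy
  · apply sq_eq_sq_iff_eq_or_eq_neg.mp
    rw [hψ, inv_sqrt_sq, div_pow, h1]
    field_simp
  · exact absurd h4 hy

theorem exists_representation_eq_neg (h : DualRecurrence R E d r)
    (hψ : ∀ x y, ⟪ψ x, ψ y⟫_ℝ = dualEigenvalue E 1 x y / d) (x : X) : ∃ y, ψ y = -ψ x := by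
  obtain ⟨σ, hσ⟩ := h.exists_perm_rel_iff
  obtain ⟨y, hy⟩ := h.scheme.exists_rel (σ.symm 4) x
  rw [hσ, ← hψ, σ.apply_symm_apply] at hy
  have hinner : ⟪ψ x, ψ y⟫_ℝ = -1 := hy
  refine ⟨y, (inner_eq_one_iff_of_norm_eq_one (𝕜 := ℝ) (h.norm_representation hψ y) ?_).mp ?_⟩
  · rw [norm_neg, h.norm_representation hψ]
  · rw [inner_neg_right, real_inner_comm, hinner, neg_neg]

theorem exists_orthonormalBasis_of_qAntipodalClass [FiniteDimensional ℝ F]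
    (h : DualRecurrence R E d r) (hF : Module.finrank ℝ F = d)
    (hψ : ∀ x y, ⟪ψ x, ψ y⟫_ℝ = dualEigenvalue E 1 x y / d) (x₀ : X) :
    ∃ b : OrthonormalBasis (Fin d) ℝ F, (∀ i, ∃ x ∈ qAntipodalClass E x₀, ψ x = b i) ∧
      ∀ x ∈ qAntipodalClass E x₀, ∃ i, ψ x = b i ∨ ψ x = -b i := by
  classical
  obtain ⟨b, hbmem, hbcover⟩ := exists_orthonormalBasis_of_two_mul_finrank_le_card
    (ι := Fin d) (by rw [Fintype.card_fin, hF]) ((qAntipodalClass E x₀).toFinset.image ψ)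
    (by rw [Finset.card_image_of_injective _ (h.representation_injective hψ),
      ← Set.ncard_eq_toFinset_card', h.ncard_qAntipodalClass, hF])
    (by simp [h.norm_representation hψ])
    (by
      simp only [Finset.forall_mem_image, Set.mem_toFinset]
      intro x hx y hy
      rw [← h.qAntipodalClass_eq_iff] at hx hy
      exact h.inner_representation_of_mem hψ (h.qAntipodalClass_eq_iff.mp (hx.symm.trans hy)))
  exact ⟨b, by simpa using hbmem, by simpa using hbcover⟩

end Representation

theorem exists_mub (h : DualRecurrence R E d r) :
    ∃ (M : Fin (numQAntipodalClasses E) →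
        OrthonormalBasis (Fin d) ℝ (EuclideanSpace ℝ (Fin d)))
      (φ : X ≃ mubPoints M), IsMUB M ∧
      ∀ x y, ⟪(φ x : EuclideanSpace ℝ (Fin d)), φ y⟫_ℝ = dualEigenvalue E 1 x y / d := by
  obtain ⟨ψ, hψ⟩ := h.exists_representation (F := EuclideanSpace ℝ (Fin d)) (by simp)
  obtain ⟨s, hs, hs'⟩ := h.exists_qAntipodalClass_representatives
  choose b hbmem hbcover using
    fun a => h.exists_orthonormalBasis_of_qAntipodalClass (by simp) hψ (s a)
  have hmub : IsMUB b := by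
    intro a a' haa' i j
    obtain ⟨x, hx, hxi⟩ := hbmem a i
    obtain ⟨y, hy, hyj⟩ := hbmem a' j
    rw [← hxi, ← hyj]
    refine h.inner_representation_of_notMem hψ fun hxy => haa' (hs a a' ?_)
    rw [← h.qAntipodalClass_eq_iff] at hx hy hxy
    rw [hx, hxy, hy]
  have hψmem (x : X) : ψ x ∈ mubPoints b := by
    obtain ⟨a, ha⟩ := hs' x
    exact ⟨a, hbcover a x ha⟩
  have hbij : Function.Bijective fun x => (⟨ψ x, hψmem x⟩ : mubPoints b) := by
    refine ⟨fun x y hxy => h.representation_injective hψ (congrArg Subtype.val hxy), ?_⟩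
    rintro ⟨_, a, i, rfl | rfl⟩ <;> obtain ⟨x, -, hx⟩ := hbmem a i
    · exact ⟨x, Subtype.ext hx⟩
    · obtain ⟨y, hy⟩ := h.exists_representation_eq_neg hψ x
      exact ⟨y, Subtype.ext (hy.trans (congrArg _ hx))⟩
  exact ⟨b, Equiv.ofBijective _ hbij, hmub, hψ⟩

end DualRecurrence

theorem theorem4p2 :
    (∀ (X : Type*) [Fintype X] [DecidableEq X] (R : Fin 5 → X → X → Prop)
      (E : Fin 5 → Matrix X X ℝ) (d f : ℕ),
      IsSymmetricAssociationScheme R → IsPrimitiveIdempotentOrdering R E →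
      IsQPolynomial E → IsQAntipodal E → IsQBipartite E →
      (E 1).rank = d → numQAntipodalClasses E = f →
      (IsQuadruplyRegular R ↔ (f : ℝ) = (d : ℝ) / 2 + 1) ∧
      (∀ x, (qAntipodalClass E x).ncard = 2 * d) ∧
      ∃ (M : Fin f → OrthonormalBasis (Fin d) ℝ (EuclideanSpace ℝ (Fin d)))
        (φ : X ≃ mubPoints M) (σ : Equiv.Perm (Fin 5)),
        IsMUB M ∧
        (∀ x y, inner ℝ (φ x : EuclideanSpace ℝ (Fin d)) (φ y : EuclideanSpace ℝ (Fin d)) =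
          (Fintype.card X : ℝ) / d * E 1 x y) ∧
        ∀ k x y, R k x y ↔ mubRel M (σ k) (φ x) (φ y)) ∧
    (∀ (d f : ℕ) (M : Fin f → OrthonormalBasis (Fin d) ℝ (EuclideanSpace ℝ (Fin d))),
      2 ≤ d → 2 ≤ f → IsMUB M →
      IsSymmetricAssociationScheme (mubRel M) ∧
      (∃ E : Fin 5 → Matrix (mubPoints M) (mubPoints M) ℝ,
        IsPrimitiveIdempotentOrdering (mubRel M) E ∧
        IsQPolynomial E ∧ IsQAntipodal E ∧ IsQBipartite E ∧
        (E 1).rank = d ∧ numQAntipodalClasses E = f) ∧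
      (IsQuadruplyRegular (mubRel M) ↔ (f : ℝ) = (d : ℝ) / 2 + 1)) := by
  refine ⟨?_, ?_⟩
  · rintro X _ _ R E d f hR hE hQ hA hB rfl rfl
    have h := dualRecurrence_of_isQPolynomial hR hE hQ hA hB
    obtain ⟨M, φ, hM, hinner⟩ := h.exists_mub
    obtain ⟨σ, hσ⟩ := h.exists_perm_rel_iff
    have hrel (k : Fin 5) (x y : X) : R k x y ↔ mubRel M (σ k) (φ x) (φ y) := by
      rw [hσ, ← hinner]
      rfl
    refine ⟨?_, h.ncard_qAntipodalClass, M, φ, σ, hM, fun x y => ?_, hrel⟩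
    · rw [isQuadruplyRegular_iff_of_equiv φ σ hrel]
      exact isQuadruplyRegular_mubRel_iff h.two_le h.two_le_numQAntipodalClasses hM
    · rw [hinner, dualEigenvalue, div_mul_eq_mul_div]
  · intro d f M hd hf hM
    exact ⟨isSymmetricAssociationScheme_mubRel hd hf hM,
      ⟨mubIdempotent M, isPrimitiveIdempotentOrdering_mubIdempotent hd hf hM,
        isQPolynomial_mubIdempotent hd hf hM, isQAntipodal_mubIdempotent hd hf hM,
        isQBipartite_mubIdempotent hd hf hM, rank_mubIdempotent_one hd hf hM,
        numQAntipodalClasses_mubIdempotent hd hM⟩,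
      isQuadruplyRegular_mubRel_iff hd hf hM⟩
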